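/- Let $N\ge 1$, $\gamma,\delta\in\mathbb R$, $\lambda_1\in\mathbb C$ with $\lambda_{1I}:=\operatorname{Im}\lambda_1\neq 0$, and $a_1^{[0]},a_1^{[1]},a_1^{[2]},a_1^{[3]}\in\mathbb C$. Write $z^*$ for complex conjugation, $\dagger$ for the conjugate transpose, and for $(x,t)\in\mathbb R^2$ put $$\theta_1=\mathrm i\lambda_1\bigl(x+(2\gamma\lambda_1+4\delta\lambda_1^2)t\bigr)+a_1^{[0]}-\tfrac{\mathrm i}{4}\pi,\qquad \vartheta_{1,0}=-2\bigl[x+4\lambda_1(\gamma+3\delta\lambda_1)t\bigr]+2\mathrm i a_1^{[1]},$$ $$\vartheta_{1,1}=-4\mathrm i(\gamma+6\delta\lambda_1)t-2a_1^{[2]},\qquad \vartheta_{1,2}=8\delta t-2\mathrm i a_1^{[3]},$$ $$f_{1,l}=\sum_{m=0}^{\lfloor 2l/3\rfloor}\ \sum_{k=\max(l-2m,0)}^{\lfloor l-3m/2\rfloor}\frac{\vartheta_{1,0}^{k}}{k!}\,\frac{\vartheta_{1,1}^{2l-2k-3m}}{(2l-2k-3m)!}\,\frac{\vartheta_{1,2}^{k-l+2m}}{(k-l+2m)!}\qquad(f_{1,0}=1).$$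 Let $\mathbf F_1$ be the upper triangular $N\times N$ matrix with entries $\mathrm e^{2\theta_1}f_{1,j-i}$ for $i\le j$ and $0$ for $i>j$, let $$\mathbf B_1=\left(\frac{1}{\lambda_1-\lambda_1^*}\binom{i+j-2}{i-1}\Bigl(\frac{\mathrm i}{\lambda_1^*-\lambda_1}\Bigr)^{i+j-2}\right)_{1\le i,j\le N},\qquad \mathbf M=\mathbf F_1^\dagger\mathbf B_1\mathbf F_1+\mathbf B_1,\qquad \mathbf G=\begin{bmatrix}\mathbf M&\mathbf F_{1,1}^\dagger\\ \mathbf e_1&0\end{bmatrix},$$ where $\mathbf F_{1,1}$ is the first row of $\mathbf F_1$ and $\mathbf e_1=[1,0,\dots,0]$. For $0\le j\le N$ let $\Gamma_j=\det\bigl(1/(j+q-p)!\bigr)_{1\le p,q\le N-j}$, where $1/n!:=0$ for $n<0$ and $\Gamma_N:=1$ (the empty determinant). For $0\le j\le N-1$ let $$\mathscr B_j(x,t)=(-1)^{N-j}(-\mathrm i)^{N-1}\,\vartheta_{1,0}^{(N-j-1)(j+1)}\,(\vartheta_{1,0}^*)^{j(N-j)}\,(2\lambda_{1I})^{-(N-j-1)^2-j^2-N+1}\,\Gamma_j\Gamma_{j+1}.$$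 Then for each $0\le j\le N-1$, $\mathscr B_j$ is a polynomial in $(x,t)$ of total degree exactly $d_j=(N-j-1)(j+1)+j(N-j)$, and there are polynomials $r_0,\dots,r_{N-1}\in\mathbb C[x,t]$ such that every monomial of $r_j$ has total degree strictly less than $d_j$ (so $r_j=0$ if $d_j=0$) and, for all $x,t\in\mathbb R$, $$\det\mathbf G=\sum_{j=0}^{N-1}\mathrm e^{2\theta_1^*}\,\mathrm e^{2(N-j-1)(\theta_1+\theta_1^*)}\bigl(\mathscr B_j(x,t)+r_j(x,t)\bigr).$$ -/

import Mathlib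

open scoped Matrix ComplexConjugate

namespace HirotaSoliton

noncomputable section

/-- The phase `θ₁ = i λ₁ (x + (2 γ λ₁ + 4 δ λ₁²) t) + a₁^{[0]} - (i/4) π`. -/
def theta (γ δ : ℝ) (lam : ℂ) (a : Fin 4 → ℂ) (x t : ℝ) : ℂ :=
  Complex.I * lam * (x + (2 * γ * lam + 4 * δ * lam ^ 2) * t) + a 0 - Complex.I / 4 * Real.pi

/-- `ϑ_{1,0} = -2 [x + 4 λ₁ (γ + 3 δ λ₁) t] + 2 i a₁^{[1]}`. -/
def vartheta0 (γ δ : ℝ) (lam : ℂ) (a : Fin 4 → ℂ) (x t : ℝ) : ℂ :=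
  -2 * (x + 4 * lam * (γ + 3 * δ * lam) * t) + 2 * Complex.I * a 1

/-- `ϑ_{1,1} = -4 i (γ + 6 δ λ₁) t - 2 a₁^{[2]}`. -/
def vartheta1 (γ δ : ℝ) (lam : ℂ) (a : Fin 4 → ℂ) (t : ℝ) : ℂ :=
  -4 * Complex.I * (γ + 6 * δ * lam) * t - 2 * a 2

/-- `ϑ_{1,2} = 8 δ t - 2 i a₁^{[3]}`. -/
def vartheta2 (δ : ℝ) (a : Fin 4 → ℂ) (t : ℝ) : ℂ :=
  8 * δ * t - 2 * Complex.I * a 3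

/-- `f_{1,l}`, the coefficient of `ε ^ l` in `exp (ε ϑ_{1,0} + ε² ϑ_{1,1} + ε³ ϑ_{1,2})`.
The truncated subtraction `l - 2 * m` is `max (l - 2 m) 0`; no other subtraction truncates. -/
def f (γ δ : ℝ) (lam : ℂ) (a : Fin 4 → ℂ) (l : ℕ) (x t : ℝ) : ℂ :=
  ∑ m ∈ Finset.range (2 * l / 3 + 1), ∑ k ∈ Finset.Icc (l - 2 * m) ((2 * l - 3 * m) / 2),
    vartheta0 γ δ lam a x t ^ k / (k.factorial : ℂ)
      * (vartheta1 γ δ lam a t ^ (2 * l - 2 * k - 3 * m)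
          / ((2 * l - 2 * k - 3 * m).factorial : ℂ))
      * (vartheta2 δ a t ^ (k + 2 * m - l) / ((k + 2 * m - l).factorial : ℂ))

/-- `f_{1,0} = 1`, so the diagonal of `F` below is `exp (2 θ₁)`. -/
theorem f_zero (γ δ : ℝ) (lam : ℂ) (a : Fin 4 → ℂ) (x t : ℝ) : f γ δ lam a 0 x t = 1 := by
  simp [f]

/-- The upper triangular Toeplitz matrix `F₁ = exp (2 θ₁) (f_{1,j-i})_{i ≤ j}`. -/
def F (N : ℕ) (γ δ : ℝ) (lam : ℂ) (a : Fin 4 → ℂ) (x t : ℝ) : Matrix (Fin N) (Fin N) ℂ :=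
  Matrix.of fun i j =>
    if i ≤ j then
      Complex.exp (2 * theta γ δ lam a x t) * f γ δ lam a ((j : ℕ) - (i : ℕ)) x t
    else 0

/-- The matrix `B₁`; with indices starting at `0` its entries are
`1 / (λ₁ - λ₁*) * binom (i + j, i) * (i / (λ₁* - λ₁)) ^ (i + j)`. -/
def B (N : ℕ) (lam : ℂ) : Matrix (Fin N) (Fin N) ℂ :=
  Matrix.of fun i j =>
    1 / (lam - conj lam) * (((i : ℕ) + (j : ℕ)).choose (i : ℕ) : ℂ)
      * (Complex.I / (conj lam - lam)) ^ ((i : ℕ) + (j : ℕ))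

/-- `M = F₁† B₁ F₁ + B₁`. -/
def M (N : ℕ) (γ δ : ℝ) (lam : ℂ) (a : Fin 4 → ℂ) (x t : ℝ) : Matrix (Fin N) (Fin N) ℂ :=
  (F N γ δ lam a x t)ᴴ * B N lam * F N γ δ lam a x t + B N lam

/-- The bordered matrix `G = [[M, F_{1,1}†], [e₁, 0]]`, where `F_{1,1}` is the first row of `F₁`
and `e₁ = [1, 0, …, 0]`. -/
def G (N : ℕ) [NeZero N] (γ δ : ℝ) (lam : ℂ) (a : Fin 4 → ℂ) (x t : ℝ) :
    Matrix (Fin N ⊕ Unit) (Fin N ⊕ Unit) ℂ :=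
  Matrix.fromBlocks (M N γ δ lam a x t)
    (Matrix.of fun i _ => conj (F N γ δ lam a x t 0 i))
    (Matrix.of fun _ j => if j = 0 then 1 else 0)
    0

/-- `Γ_j`, the determinant of order `N - j` with `(p, q)` entry `1 / (j + q - p)!`, where the
reciprocal factorial of a negative integer is `0`; the empty determinant `Γ_N` is `1`. -/
def Gam (N j : ℕ) : ℂ :=
  (Matrix.of fun p q : Fin (N - j) =>
    if (p : ℕ) ≤ j + (q : ℕ) then (1 : ℂ) / ((j + (q : ℕ) - (p : ℕ)).factorial : ℂ) else 0).det

/-- The degree `(N - j - 1) (j + 1) + j (N - j)` of the monomial `ℬ_j` in `ϑ_{1,0}`, `ϑ_{1,0}*`. -/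
def deg (N j : ℕ) : ℕ := (N - j - 1) * (j + 1) + j * (N - j)

/-- `ℬ_j (x, t)`, for `0 ≤ j ≤ N - 1`. -/
def scrB (N : ℕ) (γ δ : ℝ) (lam : ℂ) (a : Fin 4 → ℂ) (j : ℕ) (x t : ℝ) : ℂ :=
  (-1) ^ (N - j) * (-Complex.I) ^ (N - 1)
    * vartheta0 γ δ lam a x t ^ ((N - j - 1) * (j + 1))
    * conj (vartheta0 γ δ lam a x t) ^ (j * (N - j))
    * ((2 * lam.im : ℝ) : ℂ) ^ (-((N : ℤ) - j - 1) ^ 2 - (j : ℤ) ^ 2 - N + 1)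
    * (Gam N j * Gam N (j + 1))

/-- The value at `(x, t)` of a polynomial in the two indeterminates `x` and `t`. -/
def evalXT (p : MvPolynomial (Fin 2) ℂ) (x t : ℝ) : ℂ :=
  MvPolynomial.eval ![(x : ℂ), (t : ℂ)] p

end

end HirotaSoliton

/-! Swapping the border column with column 0 turns `det G` into minus the determinant of `M` with
column 0 replaced by the conjugated first row of `F`. Write `F = exp (2θ) T` with `T` the Toeplitz
matrix of the `f_l`, let `T'` be `T` with column 0 zeroed, and put `w = exp (2(θ + θ*))`. Up to the
factor `exp (2θ*)` on column 0, the replaced matrix is `[T† | 1] * middle * [(wT')ᵀ | 1]ᵀ`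
(`det_G_eq`). Cauchy–Binet expands its determinant over choices of columns in the two outer factors.
A choice with `k` columns in the left block of the right factor contributes `w ^ k`, and the block
shape of `middle` then forces `k + 1` such columns in the left factor
(`det_middle_submatrix_eq_zero`). The coefficient of `w ^ k` is therefore a polynomial in `x, t`; it
belongs to `j = N - 1 - k`. For the degrees: `f_l` equals `ϑ₀ ^ l / l!` up to terms of degree less
than `l`, so a product of `p` entries `T a i` with distinct `a` and distinct `i` has degree at most
`∑ (i - a) ≤ p (N - p)`. Equality needs the last `p` indices `i` and the first `p` indices `a`
(`sum_sub_le`). Taking `p = k + 1` on the left and `p = k` on the right gives `(k + 1) j + k (j + 1)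
= d_j`, and only one corner minor on each side survives in top degree
(`minorSum_sub_det_leading_mem`). That surviving part is itself a determinant, and `det_leading`
factors it into two Toeplitz determinants, which give the powers of `ϑ₀` and `ϑ₀*` with `Γ_{j+1}`
and `Γ_j`, and two shifted Pascal minors of `B`, which give the power of `2 Im λ₁`. The `Γ`'s are
nonzero by a Vandermonde argument, so the degree is exact. -/

namespace HirotaSoliton

/-! ### Cauchy–Binet expansions -/

section CauchyBinet

variable {n s R : Type*} [Fintype n] [DecidableEq n] [Fintype s] [CommRing R]

/-- The Cauchy–Binet formula, summed over all functions from rows to the middle index type. -/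
theorem det_mul_eq_sum (A : Matrix n s R) (B : Matrix s n R) :
    (A * B).det = ∑ f : n → s, (∏ i, A i (f i)) * (B.submatrix f id).det := by
  have h : A * B = fun i => ∑ k, A i k • B k := by
    ext i j
    simp [Matrix.mul_apply, Finset.sum_apply]
  rw [h]
  change (Matrix.detRowAlternating (R := R) (n := n)).toMultilinearMap _ = _
  rw [MultilinearMap.map_sum]
  refine Finset.sum_congr rfl fun f _ => ?_
  rw [MultilinearMap.map_smul_univ]
  rfl

theorem det_mul_mul_transpose_eq_sum (A B : Matrix n s R) (K : Matrix s s R) :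
    (A * K * Bᵀ).det = ∑ f : n → s, ∑ g : n → s,
      (∏ i, A i (f i)) * (∏ i, B i (g i)) * (K.submatrix f g).det := by
  rw [Matrix.mul_assoc, det_mul_eq_sum]
  refine Finset.sum_congr rfl fun f _ => ?_
  have h : ((K * Bᵀ).submatrix f id).det = (B * (K.submatrix f id)ᵀ).det := by
    rw [← Matrix.det_transpose (B * _), Matrix.transpose_mul, Matrix.transpose_transpose]
    rfl
  rw [h, det_mul_eq_sum, Finset.mul_sum]
  refine Finset.sum_congr rfl fun g _ => ?_
  rw [← Matrix.det_transpose, mul_assoc]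
  rfl

end CauchyBinet

/-! ### The block factorization and its nonvanishing minors -/

section Middle

variable {A : Type*} [CommRing A]

/-- The matrix `[hᵀ | 1]`. -/
def padded {N : ℕ} (h : ℕ → ℕ → A) : Matrix (Fin N) (Fin N ⊕ Fin N) A :=
  Matrix.of fun i c =>
    Sum.elim (fun a : Fin N => h a i) (fun a : Fin N => if a = i then 1 else 0) c

/-- The part of `padded` which, among minors with `p` columns in the left block,
contributes to the one of highest degree. -/
def paddedTop {N : ℕ} (p : ℕ) (h : ℕ → ℕ → A) : Matrix (Fin N) (Fin N ⊕ Fin N) A :=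
  Matrix.of fun i c =>
    Sum.elim (fun a : Fin N => if N - p ≤ (i : ℕ) ∧ (a : ℕ) < p then h a i else 0)
      (fun a : Fin N => if a = i ∧ (i : ℕ) < N - p then 1 else 0) c

/-- A matrix with its column of index `0` deleted, i.e. replaced by zero. -/
def dropZero (t : ℕ → ℕ → A) (a i : ℕ) : A := if i = 0 then 0 else t a i

/-- The middle factor in the factorization of the bordered determinant. -/
def middle (N : ℕ) (b : ℕ → ℕ → A) : Matrix (Fin N ⊕ Fin N) (Fin N ⊕ Fin N) A :=
  Matrix.fromBlocks (Matrix.of fun i j => b i j)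
    (Matrix.of fun i j => if (i : ℕ) = 0 ∧ (j : ℕ) = 0 then 1 else 0)
    0 (Matrix.of fun i j => dropZero b i j)

/-- Since column 0 is dropped, a nonzero product forces `g 0 = Sum.inr 0`. In `middle`, the left
columns and column `Sum.inr 0` live in the upper rows only, every other right column in the lower
rows only. So in a nonzero term of the Leibniz expansion, the upper rows are matched exactly with
the left columns together with column `Sum.inr 0`, one more than the left columns. -/
theorem det_middle_submatrix_eq_zero {N : ℕ} [NeZero N] (b t : ℕ → ℕ → A)
    (f g : Fin N → Fin N ⊕ Fin N)
    (hg : ∏ i, padded (N := N) (dropZero t) i (g i) ≠ 0)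
    (hc : (Finset.univ.filter fun i => (f i).isLeft).card ≠
      (Finset.univ.filter fun i => (g i).isLeft).card + 1) :
    ((middle N b).submatrix f g).det = 0 := by
  have hg' : ∀ i, padded (N := N) (dropZero t) i (g i) ≠ 0 := fun i h =>
    hg (Finset.prod_eq_zero (Finset.mem_univ i) h)
  have hr : ∀ i a, g i = Sum.inr a → a = i := by
    intro i a h
    have := hg' i
    rw [h] at this
    by_contra hne
    simp [padded, hne] at this
  have h0 : g 0 = Sum.inr 0 := by
    rcases h : g 0 with a | a
    · have := hg' 0
      rw [h] at this
      simp [padded, dropZero] at this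
    · rw [hr 0 a h]
  rw [Matrix.det_apply]
  refine Finset.sum_eq_zero fun σ _ => ?_
  by_contra hne
  have hσ : ∀ i, middle N b (f (σ i)) (g i) ≠ 0 := by
    intro i h
    refine hne ?_
    rw [Finset.prod_eq_zero (Finset.mem_univ i) (by simpa using h), smul_zero]
  apply hc
  have hset : (Finset.univ.filter fun i => (f (σ i)).isLeft) =
      insert 0 (Finset.univ.filter fun i => (g i).isLeft) := by
    ext i
    have hi := hσ i
    simp only [Finset.mem_filter, Finset.mem_univ, true_and, Finset.mem_insert]
    rcases hgi : g i with c | c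
    · rw [hgi] at hi
      rcases hfi : f (σ i) with a | a
      · simp
      · rw [hfi] at hi
        simp [middle] at hi
    · rw [hgi] at hi
      have hci := hr i c hgi
      subst hci
      rcases hfi : f (σ c) with a | a
      · rw [hfi] at hi
        simp only [middle, Matrix.fromBlocks_apply₁₂, Matrix.of_apply, ne_eq, ite_eq_right_iff,
          Classical.not_imp] at hi
        simpa using hi.1.2
      · rw [hfi] at hi
        simp only [middle, Matrix.fromBlocks_apply₂₂, Matrix.of_apply, dropZero, ne_eq,
          ite_eq_left_iff, Classical.not_imp] at hi
        simpa using fun h => hi.1 (by simp [h])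
  have hn : (0 : Fin N) ∉ Finset.univ.filter fun i => (g i).isLeft := by simp [h0]
  rw [← Finset.card_insert_of_notMem hn, ← hset]
  refine (Finset.card_bij (fun i _ => σ i) ?_ ?_ ?_).symm
  · intro i hi
    simpa using hi
  · intro i _ i' _ h
    exact σ.injective h
  · intro i hi
    exact ⟨σ.symm i, by simpa using hi, by simp⟩

end Middle

/-! ### Extremal sums of distinct indices -/

section IndexSums

/-- With the weight `p - 1 - a`, elements below `p` count nonnegatively and each element outside
costs at least 1. The cardinality term makes the inequality strict unless `S` is the initial
segment. -/
theorem sum_range_add_card_sdiff_le (S : Finset ℕ) :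
    ∑ a ∈ Finset.range S.card, (a : ℤ) + ((S \ Finset.range S.card).card : ℤ)
      ≤ ∑ a ∈ S, (a : ℤ) := by
  set p := S.card with hp
  have h1 : ∑ a ∈ S, ((p : ℤ) - 1 - a) + ((S \ Finset.range p).card : ℤ)
      ≤ ∑ a ∈ Finset.range p, ((p : ℤ) - 1 - a) := by
    have hs : ∑ a ∈ S, ((p : ℤ) - 1 - a) = ∑ a ∈ S ∩ Finset.range p, ((p : ℤ) - 1 - a) +
        ∑ a ∈ S \ Finset.range p, ((p : ℤ) - 1 - a) := (Finset.sum_inter_add_sum_sdiff _ _ _).symm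
    have ha : ∑ a ∈ S ∩ Finset.range p, ((p : ℤ) - 1 - a) ≤
        ∑ a ∈ Finset.range p, ((p : ℤ) - 1 - a) := by
      refine Finset.sum_le_sum_of_subset_of_nonneg Finset.inter_subset_right ?_
      intro a ha _
      have := Finset.mem_range.1 ha
      omega
    have hb : ∑ a ∈ S \ Finset.range p, ((p : ℤ) - 1 - a) ≤ ∑ a ∈ S \ Finset.range p, (-1 : ℤ) := by
      refine Finset.sum_le_sum fun a ha => ?_
      simp only [Finset.mem_sdiff, Finset.mem_range] at ha
      omega
    rw [Finset.sum_const, nsmul_eq_mul] at hb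
    linarith
  simp only [Finset.sum_sub_distrib, Finset.sum_const, Finset.card_range, ← hp] at h1
  linarith

/-- This is the preceding bound under the reflection `i ↦ N - 1 - i`. -/
theorem sum_le_sum_reflect_sub_card (N : ℕ) (S : Finset ℕ) (hS : ∀ i ∈ S, i < N) :
    ∑ i ∈ S, (i : ℤ) + ((S.filter fun i => i < N - S.card).card : ℤ)
      ≤ S.card * (N - 1 : ℤ) - ∑ a ∈ Finset.range S.card, (a : ℤ) := by
  have hinj : Set.InjOn (fun i => N - 1 - i) (S : Set ℕ) := by
    intro i hi j hj h
    have := hS i hi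
    have := hS j hj
    simp only at h
    omega
  have h := sum_range_add_card_sdiff_le (S.image fun i => N - 1 - i)
  rw [Finset.card_image_of_injOn hinj, Finset.sum_image hinj] at h
  have h2 : ((S.image fun i => N - 1 - i) \ Finset.range S.card) =
      (S.filter fun i => i < N - S.card).image fun i => N - 1 - i := by
    ext a
    simp only [Finset.mem_sdiff, Finset.mem_image, Finset.mem_range, Finset.mem_filter]
    constructor
    · rintro ⟨⟨i, hi, rfl⟩, h⟩
      have := hS i hi
      exact ⟨i, ⟨hi, by omega⟩, rfl⟩
    · rintro ⟨i, ⟨hi, h⟩, rfl⟩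
      have := hS i hi
      exact ⟨⟨i, hi, rfl⟩, by omega⟩
  rw [h2, Finset.card_image_of_injOn (hinj.mono (Finset.coe_subset.2 (Finset.filter_subset _ _)))] at h
  have h3 : ∑ i ∈ S, ((N - 1 - i : ℕ) : ℤ) = S.card * (N - 1 : ℤ) - ∑ i ∈ S, (i : ℤ) := by
    rw [← nsmul_eq_mul, ← Finset.sum_const, ← Finset.sum_sub_distrib]
    refine Finset.sum_congr rfl fun i hi => ?_
    have := hS i hi
    omega
  rw [h3] at h
  linarith

/-- The degree of a product of entries of `[T† | 1]` with `p` factors in the left block,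
for a function that is not the extremal one, is smaller than `p (N - p)`. -/
theorem sum_sub_le {N : ℕ} (f : Fin N → Fin N ⊕ Fin N) (v : Fin N → ℕ) (p : ℕ)
    (hp : (Finset.univ.filter fun i => (f i).isLeft).card = p)
    (hinj : ∀ i i' a, f i = Sum.inl a → f i' = Sum.inl a → i = i')
    (hl : ∀ i a, f i = Sum.inl a → (a : ℕ) + v i = i) (hr : ∀ i a, f i = Sum.inr a → v i = 0) :
    ∑ i, v i ≤ p * (N - p) ∧
      ((∃ i a, f i = Sum.inl a ∧ ¬ (N - p ≤ (i : ℕ) ∧ (a : ℕ) < p)) →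
        ∑ i, v i < p * (N - p)) := by
  set I := Finset.univ.filter fun i => (f i).isLeft with hI
  have hpN : p ≤ N := by
    rw [← hp]
    simpa using Finset.card_le_univ I
  set α : Fin N → ℕ := fun i => Sum.elim (fun a : Fin N => (a : ℕ)) (fun _ => 0) (f i) with hα
  have hmem : ∀ i, i ∈ I → ∃ a, f i = Sum.inl a := by
    intro i hi
    simpa [hI, Sum.isLeft_iff] using hi
  have hαinj : Set.InjOn α (I : Set (Fin N)) := by
    intro i hi i' hi' h
    obtain ⟨a, ha⟩ := hmem i hi
    obtain ⟨a', ha'⟩ := hmem i' hi'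
    simp only [hα, ha, ha', Sum.elim_inl] at h
    have : a = a' := Fin.ext h
    subst this
    exact hinj i i' a ha ha'
  have hvinj : Set.InjOn (fun i : Fin N => (i : ℕ)) (I : Set (Fin N)) :=
    fun i _ i' _ h => Fin.ext h
  have h1 := sum_range_add_card_sdiff_le (I.image α)
  have h2 := sum_le_sum_reflect_sub_card N (I.image fun i : Fin N => (i : ℕ)) (by
    intro i hi
    obtain ⟨j, _, rfl⟩ := Finset.mem_image.1 hi
    exact j.2)
  rw [Finset.card_image_of_injOn hαinj, Finset.sum_image hαinj, hp] at h1
  rw [Finset.card_image_of_injOn hvinj, Finset.sum_image hvinj, hp] at h2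
  have hsum : ((∑ i, v i : ℕ) : ℤ) = ∑ i ∈ I, (i : ℤ) - ∑ i ∈ I, (α i : ℤ) := by
    rw [← Finset.sum_sub_distrib, Nat.cast_sum]
    rw [← Finset.sum_subset (Finset.subset_univ I)]
    · refine Finset.sum_congr rfl fun i hi => ?_
      obtain ⟨a, ha⟩ := hmem i hi
      have := hl i a ha
      simp only [hα, ha, Sum.elim_inl]
      omega
    · intro i _ hi
      rcases h : f i with a | a
      · exact absurd (by simp [hI, h]) hi
      · simp [hr i a h]
  have hgauss : 2 * ∑ a ∈ Finset.range p, (a : ℤ) = p * (p - 1 : ℤ) := by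
    have := Finset.sum_range_id_mul_two p
    rcases p with _ | p
    · simp
    · rw [mul_comm]
      have h' : ((∑ i ∈ Finset.range (p + 1), i : ℕ) : ℤ) * 2 = (p + 1 : ℤ) * p := by
        exact_mod_cast this
      push_cast at h' ⊢
      rw [h']
      ring
  have hle : ((∑ i, v i : ℕ) : ℤ) + ((((I.image α) \ Finset.range p).card : ℤ) +
      (((I.image fun i : Fin N => (i : ℕ)).filter fun i => i < N - p).card : ℤ))
      ≤ ((p * (N - p) : ℕ) : ℤ) := by
    rw [hsum]
    push_cast [hpN]
    linarith
  refine ⟨by omega, ?_⟩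
  rintro ⟨i, a, hia, hne⟩
  have hiI : i ∈ I := by simp [hI, hia]
  rw [not_and_or] at hne
  rcases hne with hne | hne
  · have : 0 < ((I.image fun i : Fin N => (i : ℕ)).filter fun i => i < N - p).card :=
      Finset.card_pos.2 ⟨i, by
        simp only [Finset.mem_filter, Finset.mem_image]
        exact ⟨⟨i, hiI, rfl⟩, by omega⟩⟩
    omega
  · have : 0 < ((I.image α) \ Finset.range p).card :=
      Finset.card_pos.2 ⟨a, by
        simp only [Finset.mem_sdiff, Finset.mem_image, Finset.mem_range]
        exact ⟨⟨i, hiI, by simp [hα, hia]⟩, hne⟩⟩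
    omega

/-- The `p` left rows already fill the last `p` places. -/
theorem lt_sub_card_of_left {N : ℕ} (f : Fin N → Fin N ⊕ Fin N) (p : ℕ)
    (hp : (Finset.univ.filter fun i => (f i).isLeft).card = p)
    (h : ∀ i a, f i = Sum.inl a → N - p ≤ (i : ℕ)) (i a : Fin N) (hi : f i = Sum.inr a) :
    (i : ℕ) < N - p := by
  by_contra hlt
  set I := Finset.univ.filter fun i => (f i).isLeft with hI
  have hsub : insert i I ⊆ Finset.univ.filter fun i : Fin N => N - p ≤ (i : ℕ) := by
    intro i' hi'
    rw [Finset.mem_insert] at hi'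
    simp only [Finset.mem_filter, Finset.mem_univ, true_and]
    rcases hi' with rfl | hi'
    · omega
    · obtain ⟨a, ha⟩ : ∃ a, f i' = Sum.inl a := by simpa [hI, Sum.isLeft_iff] using hi'
      exact h i' a ha
  have hc := Finset.card_le_card hsub
  rw [Finset.card_insert_of_notMem (by simp [hI, hi]), hp] at hc
  have : (Finset.univ.filter fun i : Fin N => N - p ≤ (i : ℕ)).card ≤ p := by
    have hm : ((Finset.univ.filter fun i : Fin N => N - p ≤ (i : ℕ)).image
        fun i : Fin N => (i : ℕ)) ⊆ Finset.Ico (N - p) N := by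
      intro x hx
      simp only [Finset.mem_image, Finset.mem_filter, Finset.mem_univ, true_and] at hx
      obtain ⟨y, hy, rfl⟩ := hx
      simp [hy]
    have := Finset.card_le_card hm
    rw [Finset.card_image_of_injective _ Fin.val_injective, Nat.card_Ico] at this
    omega
  omega

end IndexSums

/-! ### Factorization of the leading determinant -/

section LeadingDeterminant

variable {A : Type*} [CommRing A]

theorem paddedTop_of_lt {N p : ℕ} (h : ℕ → ℕ → A) (i : Fin N) (hi : (i : ℕ) < N - p) :
    paddedTop p h i = Pi.single (Sum.inr i) 1 := by
  ext c
  rcases c with a | a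
  · simp only [paddedTop, Matrix.of_apply, Sum.elim_inl, Nat.not_le.2 hi, false_and, if_false]
    simp
  · by_cases hai : a = i
    · subst hai
      simp [paddedTop, hi]
    · simp [paddedTop, hai]

theorem paddedTop_of_le {N p : ℕ} (h : ℕ → ℕ → A) (i : Fin N) (hi : N - p ≤ (i : ℕ)) :
    paddedTop p h i =
      Sum.elim (fun a : Fin N => if (a : ℕ) < p then h a i else 0) (fun _ => 0) := by
  ext c
  rcases c with a | a
  · simp only [paddedTop, Matrix.of_apply, Sum.elim_inl, hi, true_and]
  · simp only [paddedTop, Matrix.of_apply, Sum.elim_inr, Nat.not_lt.2 hi, and_false, if_false]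

theorem sum_ite_lt_eq {N p : ℕ} (hp : p ≤ N) (F : ℕ → A) :
    ∑ a : Fin N, (if (a : ℕ) < p then F a else 0) = ∑ a : Fin p, F a := by
  rw [Fin.sum_univ_eq_sum_range (fun a => if a < p then F a else 0), Fin.sum_univ_eq_sum_range F,
    ← Finset.sum_filter]
  congr 1
  ext a
  simp only [Finset.mem_filter, Finset.mem_range]
  omega

theorem leading_apply {j k : ℕ} (u t b : ℕ → ℕ → A) (i l : Fin (j + (k + 1))) :
    (paddedTop (N := j + (k + 1)) (k + 1) u * middle (j + (k + 1)) b *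
      (paddedTop (N := j + (k + 1)) k (dropZero t))ᵀ) i l =
    if (i : ℕ) < j then (if (l : ℕ) ≤ j then dropZero b i l else 0)
    else if (l : ℕ) ≤ j then (if (l : ℕ) = 0 then u 0 i else 0)
    else ∑ a : Fin (k + 1), u a i * ∑ c : Fin k, b a c * t c l := by
  have hY : ∀ (r : Fin (j + (k + 1)) ⊕ Fin (j + (k + 1)) → A), (l : ℕ) ≤ j →
      ∑ c, r c * paddedTop k (dropZero t) l c = r (Sum.inr l) := by
    intro r hl
    rw [paddedTop_of_lt _ _ (by omega), Finset.sum_eq_single (Sum.inr l)]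
    · simp
    · intro c _ hc
      simp [hc]
    · simp
  have hY' : ∀ (r : Fin (j + (k + 1)) ⊕ Fin (j + (k + 1)) → A), ¬ (l : ℕ) ≤ j →
      ∑ c, r c * paddedTop k (dropZero t) l c =
        ∑ c : Fin (j + (k + 1)), if (c : ℕ) < k then r (Sum.inl c) * t c l else 0 := by
    intro r hl
    rw [paddedTop_of_le _ _ (by omega), Fintype.sum_sum_type]
    have : (l : ℕ) ≠ 0 := by omega
    simp [dropZero, this]
  rw [Matrix.mul_apply]
  simp only [Matrix.transpose_apply, Matrix.mul_apply]
  by_cases hi : (i : ℕ) < j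
  · rw [paddedTop_of_lt _ _ (by omega), if_pos hi]
    by_cases hl : (l : ℕ) ≤ j
    · rw [hY _ hl, if_pos hl]
      rw [Finset.sum_eq_single (Sum.inr i)]
      · simp [middle]
      · intro c _ hc
        simp [hc]
      · simp
    · rw [hY' _ hl, if_neg hl]
      simp [middle]
  · rw [paddedTop_of_le _ _ (by omega), if_neg hi]
    by_cases hl : (l : ℕ) ≤ j
    · rw [hY _ hl, if_pos hl, Fintype.sum_sum_type]
      simp only [Sum.elim_inl, Sum.elim_inr, zero_mul, Finset.sum_const_zero, add_zero, middle,
        Matrix.fromBlocks_apply₁₂, Matrix.of_apply]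
      by_cases hl0 : (l : ℕ) = 0
      · rw [if_pos hl0, Finset.sum_eq_single ⟨0, by omega⟩]
        · simp [hl0]
        · intro a _ ha
          have : (a : ℕ) ≠ 0 := fun h => ha (Fin.ext h)
          simp [this]
        · simp
      · simp [hl0]
    · rw [hY' _ hl, if_neg hl]
      have hc : ∀ c : Fin (j + (k + 1)), ∑ x, Sum.elim (fun a : Fin (j + (k + 1)) =>
          if (a : ℕ) < k + 1 then u a i else 0) (fun _ => 0) x *
            middle (j + (k + 1)) b x (Sum.inl c) = ∑ a : Fin (k + 1), u a i * b a c := by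
        intro c
        rw [Fintype.sum_sum_type, ← sum_ite_lt_eq (show k + 1 ≤ j + (k + 1) by omega)
          fun a => u a i * b a c]
        simp [middle]
      simp only [hc]
      rw [sum_ite_lt_eq (show k ≤ j + (k + 1) by omega)
        fun c => (∑ a : Fin (k + 1), u a i * b a c) * t c l]
      simp only [Finset.sum_mul, Finset.mul_sum]
      rw [Finset.sum_comm]
      simp only [mul_assoc]

theorem det_leading (j k : ℕ) (u t b : ℕ → ℕ → A) :
    (paddedTop (N := j + (k + 1)) (k + 1) u * middle (j + (k + 1)) b *
      (paddedTop (N := j + (k + 1)) k (dropZero t))ᵀ).det =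
    (-1) ^ j * ((Matrix.of fun i l : Fin j => b i (l + 1)).det *
      ((Matrix.of fun a q : Fin (k + 1) => u a (j + q)).det *
      ((Matrix.of fun a c : Fin k => b (a + 1) c).det *
        (Matrix.of fun c q : Fin k => t c (j + 1 + q)).det))) := by
  set Z : Matrix (Fin (j + (k + 1))) (Fin (j + (k + 1))) A := paddedTop (N := j + (k + 1)) (k + 1) u * middle (j + (k + 1)) b *
      (paddedTop (N := j + (k + 1)) k (dropZero t))ᵀ with hZ
  set J : Fin (j + (k + 1)) := ⟨j, by omega⟩ with hJ
  -- `W` collects what multiplies the transposed `u`-block in the last `k + 1` rows: its first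
  -- column, a unit vector, comes from column 0, and the others carry the product of `b` and `t`.
  set W : Matrix (Fin (k + 1)) (Fin (k + 1)) A := Matrix.of fun a q =>
    Fin.cases (if (a : ℕ) = 0 then 1 else 0)
      (fun q : Fin k => ∑ c : Fin k, b a c * t c (j + 1 + q)) q with hW
  -- Moving column 0 to position `j` makes the matrix block lower triangular, at the price of the
  -- sign `(-1) ^ j`.
  have hperm : (Z.submatrix id J.cycleRange).det = (-1) ^ j * Z.det := by
    rw [Matrix.det_permute', Fin.sign_cycleRange]
    simp [hJ]
  have hblock : (Z.submatrix id J.cycleRange).submatrix finSumFinEquiv finSumFinEquiv =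
      Matrix.fromBlocks (Matrix.of fun i l : Fin j => b i (l + 1)) 0
        ((Z.submatrix id J.cycleRange).submatrix finSumFinEquiv finSumFinEquiv).toBlocks₂₁
        ((Matrix.of fun a q : Fin (k + 1) => u a (j + q))ᵀ * W) := by
    have hc1 : ∀ l : Fin j, ((J.cycleRange (Fin.castAdd (k + 1) l)) : ℕ) = l + 1 := by
      intro l
      rw [Fin.cycleRange_of_lt (by simp [hJ, Fin.lt_def])]
      rw [Fin.val_add_one_of_lt']
      · simp
      · simp; omega
    have hc2 : ((J.cycleRange (Fin.natAdd j (0 : Fin (k + 1)))) : ℕ) = 0 := by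
      rw [Fin.cycleRange_of_eq (by simp [hJ, Fin.ext_iff])]
      simp
    have hc3 : ∀ q : Fin k, ((J.cycleRange (Fin.natAdd j q.succ)) : ℕ) = j + 1 + q := by
      intro q
      rw [Fin.cycleRange_of_gt (by simp [hJ, Fin.lt_def])]
      simp; omega
    ext i l
    rcases i with i | i <;> rcases l with l | l
    · simp only [Matrix.submatrix_apply, id_eq, finSumFinEquiv_apply_left,
        Matrix.fromBlocks_apply₁₁, Matrix.of_apply]
      rw [hZ, leading_apply, hc1]
      simp [dropZero]
    · simp only [Matrix.submatrix_apply, id_eq, finSumFinEquiv_apply_left,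
        finSumFinEquiv_apply_right, Matrix.fromBlocks_apply₁₂, Matrix.zero_apply]
      rw [hZ, leading_apply]
      induction l using Fin.cases with
      | zero => rw [hc2]; simp [dropZero]
      | succ q => rw [hc3, if_pos (by simp), if_neg (by omega)]
    · rfl
    · simp only [Matrix.submatrix_apply, id_eq, 
        finSumFinEquiv_apply_right, Matrix.fromBlocks_apply₂₂]
      rw [hZ, leading_apply, Matrix.mul_apply]
      induction l using Fin.cases with
      | zero =>
        rw [hc2, if_neg (by simp), if_pos (Nat.zero_le _), if_pos rfl, Finset.sum_eq_single 0]
        · simp [hW]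
        · intro a _ ha
          simp [hW, ha]
        · simp
      | succ q => rw [hc3, if_neg (by simp), if_neg (by omega)]; simp [hW]
  have hdW : W.det = (Matrix.of fun a c : Fin k => b (a + 1) c).det *
        (Matrix.of fun c q : Fin k => t c (j + 1 + q)).det := by
    rw [Matrix.det_succ_column_zero, Finset.sum_eq_single 0]
    · rw [← Matrix.det_mul]
      have : W.submatrix (Fin.succAbove 0) Fin.succ = (Matrix.of fun a c : Fin k => b (a + 1) c) *
        (Matrix.of fun c q : Fin k => t c (j + 1 + q)) := by
        ext a q
        simp [hW, Matrix.mul_apply]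
      rw [this]
      simp [hW]
    · intro a _ ha
      simp [hW, ha]
    · simp
  have hdet := Matrix.det_submatrix_equiv_self finSumFinEquiv (Z.submatrix id J.cycleRange)
  rw [hblock, Matrix.det_fromBlocks_zero₁₂, Matrix.det_mul, Matrix.det_transpose, hdW,
    hperm] at hdet
  rw [hdet, ← mul_assoc, ← pow_add, Even.neg_one_pow ⟨j, rfl⟩, one_mul]

end LeadingDeterminant

/-! ### Pascal, inverse factorial and Toeplitz determinants -/

section SpecialDeterminants

/-- Vandermonde's convolution `C(a+1+b, b) = ∑ C(a, i) C(b+1, b-i)` is a factorization into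
unitriangular matrices. -/
theorem det_choose_succ (R : Type*) [CommRing R] (n : ℕ) :
    (Matrix.of fun a b : Fin n => ((((a : ℕ) + 1 + b).choose b : ℕ) : R)).det = 1 := by
  have h : (Matrix.of fun a b : Fin n => ((((a : ℕ) + 1 + b).choose b : ℕ) : R)) =
      (Matrix.of fun a i : Fin n => (((a : ℕ).choose i : ℕ) : R)) *
      (Matrix.of fun i b : Fin n => if i ≤ b then ((((b : ℕ) + 1).choose (b - i) : ℕ) : R)
        else 0) := by
    ext a b
    simp only [Matrix.of_apply, Matrix.mul_apply]
    rw [show (a : ℕ) + 1 + b = a + (b + 1) by ring, Nat.add_choose_eq,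
      Finset.Nat.sum_antidiagonal_eq_sum_range_succ_mk, Finset.sum_range, Nat.cast_sum,
      ← sum_ite_lt_eq (N := n) (p := b + 1) b.2
        fun i => (((a : ℕ).choose i * ((b : ℕ) + 1).choose (b - i) : ℕ) : R)]
    refine Finset.sum_congr rfl fun i _ => ?_
    simp only [Nat.lt_succ_iff, Fin.le_def, Nat.cast_mul, mul_ite, mul_zero]
  rw [h, Matrix.det_mul, Matrix.det_of_isLowerTriangular, Matrix.det_of_isUpperTriangular]
  · simp
  · intro i b hib
    have : ¬ i ≤ b := not_le.2 hib
    simp [this]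
  · intro a i hai
    have : a < i := hai
    simp [Nat.choose_eq_zero_of_lt (Fin.lt_def.1 this)]

/-- Row `q` of the transpose is `1 / (j + q)!` times the falling factorials of `j + q`, which also
vanish when `p > j + q`. These are monic polynomials of degree `p`, so a Vandermonde determinant at
distinct nodes remains. -/
theorem det_inv_factorial_ne_zero (n j : ℕ) :
    (Matrix.of fun p q : Fin n =>
      if (p : ℕ) ≤ j + (q : ℕ) then (1 : ℂ) / ((j + (q : ℕ) - (p : ℕ)).factorial : ℂ)
        else 0).det ≠ 0 := by
  have h : (Matrix.of fun p q : Fin n =>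
      if (p : ℕ) ≤ j + (q : ℕ) then (1 : ℂ) / ((j + (q : ℕ) - (p : ℕ)).factorial : ℂ)
        else 0)ᵀ = Matrix.diagonal (fun q : Fin n => (1 : ℂ) / ((j + (q : ℕ)).factorial : ℂ)) *
      Matrix.of fun q p : Fin n => ((descPochhammer ℂ p).eval ((j + q : ℕ) : ℂ)) := by
    ext q p
    rw [Matrix.diagonal_mul]
    simp only [Matrix.transpose_apply, Matrix.of_apply, descPochhammer_eval_eq_descFactorial]
    have hf : ∀ m : ℕ, ((m.factorial : ℕ) : ℂ) ≠ 0 := fun m => by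
      exact_mod_cast m.factorial_ne_zero
    split_ifs with hpq
    · have := Nat.factorial_mul_descFactorial hpq
      rw [div_mul_eq_mul_div, one_mul, div_eq_div_iff (hf _) (hf _), one_mul, mul_comm]
      exact_mod_cast this.symm
    · rw [Nat.descFactorial_eq_zero_iff_lt.2 (by omega)]
      simp
  rw [← Matrix.det_transpose, h, Matrix.det_mul, Matrix.det_diagonal]
  refine mul_ne_zero (Finset.prod_ne_zero_iff.2 fun q _ => ?_) ?_
  · exact one_div_ne_zero (by exact_mod_cast Nat.factorial_ne_zero _)
  · rw [← Matrix.det_eval_matrixOfPolynomials_eq_det_vandermonde _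
      (fun p : Fin n => descPochhammer ℂ p) (fun p => descPochhammer_natDegree ℂ p)
      (fun p => monic_descPochhammer ℂ p), Matrix.det_vandermonde_ne_zero_iff]
    intro q q' hq
    apply Fin.ext
    have : j + (q : ℕ) = j + q' := by exact_mod_cast (show ((j + q : ℕ) : ℂ) = ((j + q' : ℕ) : ℂ) from hq)
    omega

/-- Scaling of a Toeplitz determinant with entries `c (j + q - p) θ ^ (j + q - p)`. -/
theorem det_toeplitz_pow {A : Type*} [CommRing A] [IsDomain A] (n j : ℕ) (c : ℕ → A) (θ : A)
    (hθ : θ ≠ 0) :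
    (Matrix.of fun p q : Fin n =>
      if (p : ℕ) ≤ j + q then θ ^ (j + q - p) * c (j + q - p) else 0).det =
    θ ^ (j * n) *
      (Matrix.of fun p q : Fin n => if (p : ℕ) ≤ j + q then c (j + q - p) else 0).det := by
  -- On the support, `θ ^ p * θ ^ (j + q - p) = θ ^ j * θ ^ q`.
  have h : Matrix.diagonal (fun p : Fin n => θ ^ (p : ℕ)) * (Matrix.of fun p q : Fin n =>
      if (p : ℕ) ≤ j + q then θ ^ (j + q - p) * c (j + q - p) else 0) =
      (Matrix.of fun p q : Fin n => if (p : ℕ) ≤ j + q then c (j + q - p) else 0) *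
      Matrix.diagonal (fun q : Fin n => θ ^ j * θ ^ (q : ℕ)) := by
    ext p q
    rw [Matrix.diagonal_mul, Matrix.mul_diagonal]
    simp only [Matrix.of_apply]
    split_ifs with hpq
    · rw [← mul_assoc, ← pow_add, ← pow_add, mul_comm]
      congr 2
      omega
    · simp
  have hd := congrArg Matrix.det h
  rw [Matrix.det_mul, Matrix.det_mul, Matrix.det_diagonal, Matrix.det_diagonal,
    Finset.prod_mul_distrib, Finset.prod_const, Finset.card_univ, Fintype.card_fin,
    ← pow_mul] at hd
  have hne : ∏ p : Fin n, θ ^ (p : ℕ) ≠ 0 := Finset.prod_ne_zero_iff.2 fun p _ => pow_ne_zero _ hθ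
  apply mul_left_cancel₀ hne
  rw [hd]
  ring

end SpecialDeterminants

/-! ### Expansion in powers of the exponential -/

section MinorSum

variable {A : Type*} [CommRing A]

/-- The contribution to the Cauchy–Binet expansion of the bordered determinant of those terms
in which the right-hand factor uses exactly `k` columns of its left block. -/
def minorSum (N : ℕ) (b u t : ℕ → ℕ → A) (k : ℕ) : A :=
  ∑ g : Fin N → Fin N ⊕ Fin N with (Finset.univ.filter fun i => (g i).isLeft).card = k,
    ∑ f : Fin N → Fin N ⊕ Fin N,
      (∏ i, padded u i (f i)) * (∏ i, padded (dropZero t) i (g i)) *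
        ((middle N b).submatrix f g).det

theorem det_padded_eq_sum (N : ℕ) [NeZero N] (b u t : ℕ → ℕ → A) (w : A) :
    (padded (N := N) u * middle N b *
      (padded (N := N) (dropZero fun a i => w * t a i))ᵀ).det =
    ∑ k ∈ Finset.range N, w ^ k * minorSum N b u t k := by
  have hw : ∀ g : Fin N → Fin N ⊕ Fin N,
      ∏ i, padded (dropZero fun a i => w * t a i) i (g i) =
        w ^ (Finset.univ.filter fun i => (g i).isLeft).card *
          ∏ i, padded (dropZero t) i (g i) := by
    intro g
    rw [Finset.card_filter, ← Finset.prod_pow_eq_pow_sum, ← Finset.prod_mul_distrib]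
    refine Finset.prod_congr rfl fun i _ => ?_
    rcases g i with a | a
    · simp [padded, dropZero]
    · simp [padded]
  -- The power `N` of `w` does not occur: it would need a left column in row 0, where the dropped
  -- column gives zero.
  have hN : ∀ g : Fin N → Fin N ⊕ Fin N,
      (Finset.univ.filter fun i => (g i).isLeft).card ∉ Finset.range N →
        ∏ i, padded (dropZero t) i (g i) = 0 := by
    intro g hg
    have h1 : (Finset.univ.filter fun i => (g i).isLeft) = Finset.univ := by
      apply Finset.eq_univ_of_card
      refine le_antisymm (Finset.card_le_univ _) ?_
      rw [Fintype.card_fin]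
      simpa using hg
    have h0 : (0 : Fin N) ∈ Finset.univ.filter fun i => (g i).isLeft := by
      rw [h1]
      exact Finset.mem_univ _
    obtain ⟨a, ha⟩ : ∃ a, g 0 = Sum.inl a := by simpa [Sum.isLeft_iff] using h0
    refine Finset.prod_eq_zero (Finset.mem_univ 0) ?_
    rw [ha]
    simp [padded, dropZero]
  have hk : ∀ k, w ^ k * minorSum N b u t k =
      ∑ g : Fin N → Fin N ⊕ Fin N with (Finset.univ.filter fun i => (g i).isLeft).card = k,
        ∑ f : Fin N → Fin N ⊕ Fin N, (∏ i, padded u i (f i)) *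
          (∏ i, padded (dropZero fun a i => w * t a i) i (g i)) *
            ((middle N b).submatrix f g).det := by
    intro k
    rw [minorSum, Finset.mul_sum]
    refine Finset.sum_congr rfl fun g hg => ?_
    rw [Finset.mul_sum]
    refine Finset.sum_congr rfl fun f _ => ?_
    rw [hw, (Finset.mem_filter.1 hg).2]
    ring
  rw [det_mul_mul_transpose_eq_sum, Finset.sum_comm, Finset.sum_congr rfl fun k _ => hk k,
    Finset.sum_fiberwise_eq_sum_filter, Finset.sum_filter_of_ne]
  intro g _ hg
  by_contra hne
  apply hg
  simp only [hw, hN g hne, mul_zero, zero_mul, Finset.sum_const_zero]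

theorem map_padded {A' : Type*} [CommRing A'] (φ : A →+* A') {N : ℕ} (h : ℕ → ℕ → A) (i : Fin N)
    (c : Fin N ⊕ Fin N) : φ (padded h i c) = padded (fun a i => φ (h a i)) i c := by
  rcases c with a | a
  · simp [padded]
  · simp [padded, apply_ite φ]

theorem map_dropZero {A' : Type*} [CommRing A'] (φ : A →+* A') (h : ℕ → ℕ → A) :
    (fun a i => φ (dropZero h a i)) = dropZero fun a i => φ (h a i) := by
  ext a i
  simp [dropZero, apply_ite φ]

theorem map_middle {A' : Type*} [CommRing A'] (φ : A →+* A') (N : ℕ) (b : ℕ → ℕ → A) :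
    (middle N b).map φ = middle N fun i j => φ (b i j) := by
  ext i j
  rcases i with i | i <;> rcases j with j | j <;>
    simp [middle, dropZero, apply_ite φ]

theorem map_det_middle {A' : Type*} [CommRing A'] (φ : A →+* A') (N : ℕ) (b : ℕ → ℕ → A)
    (f g : Fin N → Fin N ⊕ Fin N) :
    φ ((middle N b).submatrix f g).det =
      ((middle N fun i j => φ (b i j)).submatrix f g).det := by
  rw [← map_middle, RingHom.map_det]
  rfl

theorem map_minorSum {A' : Type*} [CommRing A'] (φ : A →+* A') (N : ℕ) (b u t : ℕ → ℕ → A)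
    (k : ℕ) :
    φ (minorSum N b u t k) = minorSum N (fun i j => φ (b i j)) (fun i j => φ (u i j))
      (fun i j => φ (t i j)) k := by
  simp only [minorSum, map_sum, map_mul, map_prod, map_padded, map_det_middle, map_dropZero]

end MinorSum

/-! ### Degree filtration and top-degree parts -/

section Filtration

open MvPolynomial

variable {σ : Type*}

/-- The polynomials all of whose monomials have degree less than `d`. -/
noncomputable def degLT (σ : Type*) (d : ℕ) : Submodule ℂ (MvPolynomial σ ℂ) :=
  restrictSupport ℂ {m | m.degree < d}

theorem mem_degLT {d : ℕ} {p : MvPolynomial σ ℂ} :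
    p ∈ degLT σ d ↔ ∀ m ∈ p.support, m.degree < d := by
  rw [degLT, mem_restrictSupport_iff]
  rfl

theorem degLT_mono {d e : ℕ} (h : d ≤ e) : degLT σ d ≤ degLT σ e :=
  restrictSupport_mono ℂ fun _ hm => lt_of_lt_of_le hm h

/-- Strict bounds are used so that `degLT σ 0` is zero, which covers `d_j = 0`. One factor has
degree at most `d`, the other less than `e`, hence the single `+ 1`. -/
theorem mul_mem_degLT {d e : ℕ} {p q : MvPolynomial σ ℂ} (hp : p ∈ degLT σ (d + 1))
    (hq : q ∈ degLT σ e) : p * q ∈ degLT σ (d + e) := by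
  classical
  rw [mem_degLT] at *
  intro m hm
  obtain ⟨m₁, h₁, m₂, h₂, rfl⟩ := Finset.mem_add.1 (support_mul p q hm)
  have h1 := hp _ h₁
  have h2 := hq _ h₂
  rw [map_add]
  omega

theorem C_mem_degLT (c : ℂ) : (C c : MvPolynomial σ ℂ) ∈ degLT σ 1 := by
  classical
  rw [mem_degLT]
  intro m hm
  rw [mem_support_iff, coeff_C] at hm
  have : 0 = m := by
    by_contra h
    simp [h] at hm
  simp [← this]

/-- `p` has degree at most `d`, and agrees with `q` up to terms of degree less than `d`. -/
def HasTop (d : ℕ) (p q : MvPolynomial σ ℂ) : Prop :=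
  p ∈ degLT σ (d + 1) ∧ p - q ∈ degLT σ d

namespace HasTop

theorem right_mem {d : ℕ} {p q : MvPolynomial σ ℂ} (h : HasTop d p q) : q ∈ degLT σ (d + 1) := by
  have := Submodule.sub_mem _ h.1 (degLT_mono (Nat.le_succ d) h.2)
  simpa using this

theorem refl {d : ℕ} {p : MvPolynomial σ ℂ} (h : p ∈ degLT σ (d + 1)) : HasTop d p p :=
  ⟨h, by simp⟩

theorem zero (d : ℕ) : HasTop d (0 : MvPolynomial σ ℂ) 0 := refl (Submodule.zero_mem _)

theorem C (c : ℂ) : HasTop 0 (MvPolynomial.C c : MvPolynomial σ ℂ) (MvPolynomial.C c) :=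
  refl (C_mem_degLT c)

theorem mono {d e : ℕ} {p q : MvPolynomial σ ℂ} (h : HasTop d p q) (hde : d ≤ e) :
    HasTop e p q :=
  ⟨degLT_mono (by omega) h.1, degLT_mono hde h.2⟩

theorem mul {d e : ℕ} {p q p' q' : MvPolynomial σ ℂ} (h : HasTop d p q) (h' : HasTop e p' q') :
    HasTop (d + e) (p * p') (q * q') := by
  refine ⟨by simpa [add_assoc] using mul_mem_degLT h.1 h'.1, ?_⟩
  have : p * p' - q * q' = p' * (p - q) + q * (p' - q') := by ring
  rw [this]
  refine Submodule.add_mem _ ?_ (mul_mem_degLT h.right_mem h'.2)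
  rw [add_comm d e]
  exact mul_mem_degLT h'.1 h.2

theorem prod {ι : Type*} (s : Finset ι) (d : ι → ℕ) (p q : ι → MvPolynomial σ ℂ)
    (h : ∀ i ∈ s, HasTop (d i) (p i) (q i)) :
    HasTop (∑ i ∈ s, d i) (∏ i ∈ s, p i) (∏ i ∈ s, q i) := by
  classical
  induction s using Finset.induction_on with
  | empty => simpa using C (σ := σ) 1
  | insert i s hi ih =>
    rw [Finset.sum_insert hi, Finset.prod_insert hi, Finset.prod_insert hi]
    exact (h i (Finset.mem_insert_self i s)).mul
      (ih fun i' hi' => h i' (Finset.mem_insert_of_mem hi'))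

end HasTop

/-- If some factor vanishes by triangularity, both products are zero. Otherwise the degree bound is
`∑ (i - a)`: for an extremal choice `paddedTop` and `padded` agree factor by factor, and for any
other choice the `paddedTop` product is zero while the degree is below `p (N - p)`. -/
theorem hasTop_prod_padded {N : ℕ} (h h0 : ℕ → ℕ → MvPolynomial σ ℂ)
    (hle : ∀ a i, a ≤ i → HasTop (i - a) (h a i) (h0 a i))
    (hlt : ∀ a i, i < a → h a i = 0 ∧ h0 a i = 0) (f : Fin N → Fin N ⊕ Fin N)
    (hf : Function.Injective f) (p : ℕ)
    (hp : (Finset.univ.filter fun i => (f i).isLeft).card = p) :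
    HasTop (p * (N - p)) (∏ i, padded h i (f i)) (∏ i, paddedTop p h0 i (f i)) := by
  by_cases hv : ∀ i, (∀ a, f i = Sum.inl a → a ≤ i) ∧ (∀ a, f i = Sum.inr a → a = i)
  · set v : Fin N → ℕ := fun i => Sum.elim (fun a : Fin N => (i : ℕ) - a) (fun _ => 0) (f i)
      with hvdef
    have htop : HasTop (∑ i, v i) (∏ i, padded h i (f i)) (∏ i, padded h0 i (f i)) := by
      refine HasTop.prod _ _ _ _ fun i _ => ?_
      rcases hfi : f i with a | a
      · simpa [hvdef, hfi, padded] using hle a i ((hv i).1 a hfi)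
      · simpa [hvdef, hfi, padded, (hv i).2 a hfi] using HasTop.C (σ := σ) 1
    obtain ⟨h1, h2⟩ := sum_sub_le f v p hp (fun i i' a hi hi' => hf (hi.trans hi'.symm))
      (fun i a hia => by
        have := Fin.le_def.1 ((hv i).1 a hia)
        simp only [hvdef, hia, Sum.elim_inl]
        omega)
      (fun i a hia => by simp [hvdef, hia])
    by_cases hex : ∃ i a, f i = Sum.inl a ∧ ¬ (N - p ≤ (i : ℕ) ∧ (a : ℕ) < p)
    · obtain ⟨i, a, hia, hne⟩ := hex
      have hzero : ∏ i, paddedTop p h0 i (f i) = 0 := by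
        refine Finset.prod_eq_zero (Finset.mem_univ i) ?_
        simp only [hia, paddedTop, Matrix.of_apply, Sum.elim_inl, if_neg hne]
      have hlt' := h2 ⟨i, a, hia, hne⟩
      rw [hzero]
      exact ⟨degLT_mono (by omega) htop.1, by simpa using degLT_mono (by omega) htop.1⟩
    · push Not at hex
      have heq : ∏ i, paddedTop p h0 i (f i) = ∏ i, padded h0 i (f i) := by
        refine Finset.prod_congr rfl fun i _ => ?_
        rcases hfi : f i with a | a
        · simp only [paddedTop, padded, Matrix.of_apply, Sum.elim_inl, if_pos (hex i a hfi)]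
        · have := lt_sub_card_of_left f p hp (fun i a hia => (hex i a hia).1) i a hfi
          simp only [paddedTop, padded, Matrix.of_apply, Sum.elim_inr, this, and_true]
      rw [heq]
      exact htop.mono h1
  · push Not at hv
    obtain ⟨i, hi⟩ := hv
    have hz : padded h i (f i) = 0 ∧ paddedTop p h0 i (f i) = 0 := by
      rcases hfi : f i with a | a
      · have hai : i < a := by
          by_contra hge
          obtain ⟨c, hc, hne⟩ := hi fun c hc => by
            rw [hfi] at hc
            exact Sum.inl_injective hc ▸ not_lt.1 hge
          simp [hfi] at hc
        have := hlt a i (Fin.lt_def.1 hai)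
        simp [padded, paddedTop, this]
      · obtain ⟨c, hc, hne⟩ := hi fun c hc => by simp [hfi] at hc
        rw [hfi] at hc
        have : a ≠ i := by
          rw [Sum.inr_injective hc]
          exact hne
        simp [padded, paddedTop, this]
    rw [Finset.prod_eq_zero (Finset.mem_univ i) hz.1,
      Finset.prod_eq_zero (Finset.mem_univ i) hz.2]
    exact HasTop.zero _

theorem paddedTop_eq_zero {N p : ℕ} {h : ℕ → ℕ → MvPolynomial σ ℂ} {i : Fin N}
    {c : Fin N ⊕ Fin N} (hc : padded h i c = 0) : paddedTop p h i c = 0 := by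
  rcases c with a | a
  · simp only [padded, Matrix.of_apply, Sum.elim_inl] at hc
    simp [paddedTop, hc]
  · by_cases hai : a = i
    · simp [padded, hai] at hc
    · simp [paddedTop, hai]

theorem card_left_of_prod_paddedTop_ne_zero {N p : ℕ} (hp : p ≤ N)
    (h : ℕ → ℕ → MvPolynomial σ ℂ)
    (g : Fin N → Fin N ⊕ Fin N) (hg : ∏ i, paddedTop p h i (g i) ≠ 0) :
    (Finset.univ.filter fun i => (g i).isLeft).card = p := by
  have hset : (Finset.univ.filter fun i => (g i).isLeft) =
      Finset.univ.filter fun i : Fin N => N - p ≤ (i : ℕ) := by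
    ext i
    have hi : paddedTop p h i (g i) ≠ 0 := fun h0 => hg (Finset.prod_eq_zero (Finset.mem_univ i) h0)
    simp only [Finset.mem_filter, Finset.mem_univ, true_and]
    rcases hgi : g i with a | a
    · rw [hgi] at hi
      simp only [paddedTop, Matrix.of_apply, Sum.elim_inl, ne_eq, ite_eq_right_iff,
        Classical.not_imp] at hi
      simpa using hi.1.1
    · rw [hgi] at hi
      simp only [paddedTop, Matrix.of_apply, Sum.elim_inr, ne_eq, ite_eq_right_iff,
        Classical.not_imp] at hi
      simpa using Nat.lt_sub_iff_add_lt.1 hi.1.2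
  rw [hset, ← Finset.card_image_of_injective _ Fin.val_injective]
  have : (Finset.univ.filter fun i : Fin N => N - p ≤ (i : ℕ)).image (fun i : Fin N => (i : ℕ)) =
      Finset.Ico (N - p) N := by
    ext x
    simp only [Finset.mem_image, Finset.mem_filter, Finset.mem_univ, true_and, Finset.mem_Ico]
    exact ⟨fun ⟨y, hy, hyx⟩ => by omega, fun hx => ⟨⟨x, hx.2⟩, hx.1, rfl⟩⟩
  rw [this, Nat.card_Ico]
  omega

/-- Both sides have Cauchy–Binet expansions with the same minors of `middle`, which are constants,
so the comparison is term by term. Repeated rows or columns kill the minor; otherwise the two outer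
products are controlled by `hasTop_prod_padded`, with degrees `(k + 1) j` and `k (j + 1)`. -/
theorem minorSum_sub_det_leading_mem (j k : ℕ) (b : ℕ → ℕ → ℂ)
    (u u0 t t0 : ℕ → ℕ → MvPolynomial σ ℂ)
    (hu : ∀ a i, a ≤ i → HasTop (i - a) (u a i) (u0 a i))
    (hu' : ∀ a i, i < a → u a i = 0 ∧ u0 a i = 0)
    (ht : ∀ a i, a ≤ i → HasTop (i - a) (t a i) (t0 a i))
    (ht' : ∀ a i, i < a → t a i = 0 ∧ t0 a i = 0) :
    minorSum (j + (k + 1)) (fun i l => C (b i l)) u t k -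
      Matrix.det (paddedTop (N := j + (k + 1)) (k + 1) u0 * middle (j + (k + 1)) (fun i l => (C (b i l) : MvPolynomial σ ℂ)) *
        (paddedTop (N := j + (k + 1)) k (dropZero t0))ᵀ) ∈
      degLT σ (k * (j + 1) + j * (k + 1)) := by
  rw [det_mul_mul_transpose_eq_sum, Finset.sum_comm]
  have hsum : ∀ F : (Fin (j + (k + 1)) → Fin (j + (k + 1)) ⊕ Fin (j + (k + 1))) →
      MvPolynomial σ ℂ, (∀ g, F g ≠ 0 → (Finset.univ.filter fun i => (g i).isLeft).card = k) →
      ∑ g, F g = ∑ g with (Finset.univ.filter fun i => (g i).isLeft).card = k, F g :=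
    fun F hF => (Finset.sum_filter_of_ne fun g _ => hF g).symm
  rw [hsum]
  swap
  · intro g hg
    apply card_left_of_prod_paddedTop_ne_zero (by omega) (dropZero t0)
    intro h0
    simp [h0] at hg
  rw [minorSum, ← Finset.sum_sub_distrib]
  refine Submodule.sum_mem _ fun g hg => ?_
  replace hg := (Finset.mem_filter.1 hg).2
  rw [← Finset.sum_sub_distrib]
  refine Submodule.sum_mem _ fun f _ => ?_
  rw [← sub_mul]
  by_cases hinjf : Function.Injective f
  swap
  · rw [Function.Injective] at hinjf
    push Not at hinjf
    obtain ⟨i, i', h, hne⟩ := hinjf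
    rw [Matrix.det_zero_of_row_eq hne (by ext l; simp [h])]
    simp
  by_cases hinjg : Function.Injective g
  swap
  · rw [Function.Injective] at hinjg
    push Not at hinjg
    obtain ⟨i, i', h, hne⟩ := hinjg
    rw [Matrix.det_zero_of_column_eq hne (by intro l; simp [h])]
    simp
  have hdz : ∀ a i, a ≤ i → HasTop (i - a) (dropZero t a i) (dropZero t0 a i) := by
    intro a i hai
    rw [dropZero, dropZero]
    split_ifs
    · exact HasTop.zero _
    · exact ht a i hai
  have hdz' : ∀ a i, i < a → dropZero t a i = 0 ∧ dropZero t0 a i = 0 := by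
    intro a i hai
    simp [dropZero, ht' a i hai]
  have hG := hasTop_prod_padded (dropZero t) (dropZero t0) hdz hdz' g hinjg k hg
  by_cases hcard : (Finset.univ.filter fun i => (f i).isLeft).card = k + 1
  · have hF := hasTop_prod_padded u u0 hu hu' f hinjf (k + 1) hcard
    have htop := (hF.mul hG).2
    rw [← map_det_middle]
    generalize ((middle (j + (k + 1)) b).submatrix f g).det = c
    rw [mul_comm _ (C c), C_mul']
    refine Submodule.smul_mem _ _ (degLT_mono (le_of_eq ?_) htop)
    rw [show j + (k + 1) - (k + 1) = j by omega, show j + (k + 1) - k = j + 1 by omega]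
    ring
  -- With the wrong number of left columns in `f`, either the minor vanishes or the product over `g`
  -- does, for `t` and for `t0` alike.
  · set D := ((middle (j + (k + 1)) fun i l => (C (b i l) : MvPolynomial σ ℂ)).submatrix f g).det
      with hD
    by_cases hD0 : D = 0
    · simp [hD0]
    have hzero : ∀ s : ℕ → ℕ → MvPolynomial σ ℂ, ∏ i, padded (dropZero s) i (g i) = 0 := by
      intro s
      by_contra hne
      exact hD0 (det_middle_submatrix_eq_zero _ s f g hne (by rw [hg]; exact hcard))
    obtain ⟨i, -, hi⟩ := Finset.prod_eq_zero_iff.1 (hzero t0)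
    have hz : ∏ i, paddedTop k (dropZero t0) i (g i) = 0 :=
      Finset.prod_eq_zero (Finset.mem_univ i) (paddedTop_eq_zero hi)
    rw [hzero t, hz]
    simp

end Filtration

/-! ### The bordered determinant as a product of three factors -/

section Bordered

variable {A : Type*} [CommRing A]

theorem padded_mul_middle_apply {N : ℕ} [NeZero N] (b u t : ℕ → ℕ → A) (i l : Fin N) :
    (padded (N := N) u * middle N b * (padded (N := N) (dropZero t))ᵀ) i l =
      if l = 0 then u 0 i
      else ∑ c : Fin N, (∑ a : Fin N, u a i * b a c) * t c l + b i l := by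
  have hY : ∀ r : Fin N ⊕ Fin N → A, ∑ c, r c * padded (dropZero t) l c =
      ∑ c : Fin N, r (Sum.inl c) * dropZero t c l + r (Sum.inr l) := by
    intro r
    rw [Fintype.sum_sum_type]
    simp [padded]
  have hX : ∀ r : Fin N ⊕ Fin N → A, ∑ c, padded u i c * r c =
      ∑ c : Fin N, u c i * r (Sum.inl c) + r (Sum.inr i) := by
    intro r
    rw [Fintype.sum_sum_type]
    simp [padded]
  rw [Matrix.mul_apply]
  simp only [Matrix.transpose_apply]
  rw [hY]
  simp only [Matrix.mul_apply, hX]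
  by_cases hl : l = 0
  · subst hl
    rw [if_pos rfl, Finset.sum_eq_zero (fun c _ => by simp [dropZero]), zero_add,
      Finset.sum_eq_single 0]
    · simp [middle, dropZero]
    · intro a _ ha
      simp [middle, ha]
    · simp
  · have hl' : (l : ℕ) ≠ 0 := fun h => hl (Fin.ext (by simpa using h))
    rw [if_neg hl]
    simp [middle, dropZero, hl]

theorem det_fromBlocks_border {N : ℕ} [NeZero N] (P : Matrix (Fin N) (Fin N) A) (v : Fin N → A) :
    (Matrix.fromBlocks P (Matrix.of fun i (_ : Unit) => v i)
      (Matrix.of fun (_ : Unit) (l : Fin N) => if l = 0 then 1 else 0) 0).det =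
      -(P.updateCol 0 v).det := by
  set Q := Matrix.fromBlocks P (Matrix.of fun i (_ : Unit) => v i)
      (Matrix.of fun (_ : Unit) (l : Fin N) => if l = 0 then 1 else 0) 0 with hQ
  set τ : Equiv.Perm (Fin N ⊕ Unit) := Equiv.swap (Sum.inl 0) (Sum.inr ()) with hτ
  -- After the swap the bottom row is `[0, …, 0, 1]`, so the matrix is block upper triangular.
  have h : Q.submatrix id τ = Matrix.fromBlocks (P.updateCol 0 v)
      (Matrix.of fun i (_ : Unit) => P i 0) 0 1 := by
    ext i l
    rcases l with l | l
    · by_cases hl : l = 0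
      · subst hl
        rcases i with i | i <;> simp [hτ, hQ]
      · have : τ (Sum.inl l) = Sum.inl l :=
          Equiv.swap_apply_of_ne_of_ne (by simpa using hl) (by simp)
        rcases i with i | i <;> simp [hQ, this, hl]
    · rcases i with i | i <;> simp [hτ, hQ]
  have hd := Matrix.det_permute' τ Q
  rw [h, Matrix.det_fromBlocks_zero₂₁, hτ, Equiv.Perm.sign_swap (by simp)] at hd
  simp only [Matrix.det_one, mul_one, Units.val_neg, Units.val_one, Int.cast_neg, Int.cast_one,
    neg_mul, one_mul] at hd
  rw [hd, neg_neg]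

end Bordered

/-- The unscaled entries of `F`. -/
noncomputable def toeplitzF (γ δ : ℝ) (lam : ℂ) (a : Fin 4 → ℂ) (x t : ℝ) (i j : ℕ) : ℂ :=
  if i ≤ j then f γ δ lam a (j - i) x t else 0

/-- The entries of `B`. -/
noncomputable def entryB (lam : ℂ) (i j : ℕ) : ℂ :=
  1 / (lam - conj lam) * ((i + j).choose i : ℂ) * (Complex.I / (conj lam - lam)) ^ (i + j)

theorem det_G_eq (N : ℕ) [NeZero N] (γ δ : ℝ) (lam : ℂ) (a : Fin 4 → ℂ) (x t : ℝ) :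
    (G N γ δ lam a x t).det = -(Complex.exp (2 * conj (theta γ δ lam a x t)) *
      (padded (N := N) (fun i j => conj (toeplitzF γ δ lam a x t i j)) * middle N (entryB lam) *
        (padded (N := N) (dropZero fun i j =>
          Complex.exp (2 * (theta γ δ lam a x t + conj (theta γ δ lam a x t))) *
            toeplitzF γ δ lam a x t i j))ᵀ).det) := by
  set θ := theta γ δ lam a x t with hθ
  set Z := padded (N := N) (fun i j => conj (toeplitzF γ δ lam a x t i j)) *
    middle N (entryB lam) * (padded (N := N) (dropZero fun i j =>
      Complex.exp (2 * (θ + conj θ)) * toeplitzF γ δ lam a x t i j))ᵀ with hZ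
  have hF : ∀ i j, F N γ δ lam a x t i j = Complex.exp (2 * θ) * toeplitzF γ δ lam a x t i j := by
    intro i j
    simp only [F, toeplitzF, Matrix.of_apply, Fin.le_def, mul_ite, mul_zero, hθ]
  have hexp : conj (Complex.exp (2 * θ)) = Complex.exp (2 * conj θ) := by
    rw [← Complex.exp_conj, map_mul, map_ofNat]
  have hw : Complex.exp (2 * (θ + conj θ)) = Complex.exp (2 * conj θ) * Complex.exp (2 * θ) := by
    rw [← Complex.exp_add]
    ring_nf
  -- Only column 0 keeps an unpaired `exp (2θ*)`; in the other columns the exponentials of `F†` and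
  -- `F` combine into `w`.
  have hcol : (M N γ δ lam a x t).updateCol 0 (fun i => conj (F N γ δ lam a x t 0 i)) =
      Z.updateCol 0 (Complex.exp (2 * conj θ) • fun i => Z i 0) := by
    ext i l
    by_cases hl : l = 0
    · subst hl
      rw [Matrix.updateCol_self, Matrix.updateCol_self, Pi.smul_apply, hZ,
        padded_mul_middle_apply, if_pos rfl, hF, map_mul, hexp]
      rfl
    · rw [Matrix.updateCol_ne hl, Matrix.updateCol_ne hl, hZ, padded_mul_middle_apply, if_neg hl,
        M, Matrix.add_apply, Matrix.mul_apply]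
      congr 1
      refine Finset.sum_congr rfl fun c _ => ?_
      rw [Matrix.mul_apply, hF, hw, Finset.sum_mul, Finset.sum_mul]
      refine Finset.sum_congr rfl fun d _ => ?_
      rw [Matrix.conjTranspose_apply, hF, ← starRingEnd_apply, map_mul, hexp]
      simp only [B, entryB, Matrix.of_apply]
      ring
  rw [G, det_fromBlocks_border, hcol, Matrix.det_updateCol_smul]
  congr 2
  exact congrArg _ (Matrix.updateCol_eq_self Z 0)

/-! ### The entries as polynomials in `x` and `t` -/

section Polynomials

open MvPolynomial

/-- The polynomial `c₀ x + c₁ t + c₂`. -/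
noncomputable def linXT (c₀ c₁ c₂ : ℂ) : MvPolynomial (Fin 2) ℂ :=
  C c₀ * X 0 + C c₁ * X 1 + C c₂

theorem eval_linXT (c₀ c₁ c₂ : ℂ) (x t : ℝ) :
    eval ![(x : ℂ), (t : ℂ)] (linXT c₀ c₁ c₂) = c₀ * x + c₁ * t + c₂ := by
  simp [linXT]

theorem X_mem_degLT {σ : Type*} (i : σ) : (X i : MvPolynomial σ ℂ) ∈ degLT σ 2 := by
  rw [mem_degLT]
  intro m hm
  rw [support_X, Finset.mem_singleton] at hm
  simp [hm]

theorem linXT_mem_degLT (c₀ c₁ c₂ : ℂ) : linXT c₀ c₁ c₂ ∈ degLT (Fin 2) 2 := by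
  refine Submodule.add_mem _ (Submodule.add_mem _ ?_ ?_) ?_
  · rw [C_mul']
    exact Submodule.smul_mem _ _ (X_mem_degLT 0)
  · rw [C_mul']
    exact Submodule.smul_mem _ _ (X_mem_degLT 1)
  · exact degLT_mono (by norm_num) (C_mem_degLT c₂)

theorem coeff_linXT (c₀ c₁ c₂ : ℂ) :
    coeff (Finsupp.single 0 1) (linXT c₀ c₁ c₂) = c₀ := by
  have h : (0 : Fin 2 →₀ ℕ) ≠ Finsupp.single 0 1 := (Finsupp.single_ne_zero.2 one_ne_zero).symm
  simp [linXT, coeff_C_mul, coeff_X, coeff_C, Finsupp.single_left_inj, h]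

theorem linXT_ne_zero {c₀ : ℂ} (h : c₀ ≠ 0) (c₁ c₂ : ℂ) : linXT c₀ c₁ c₂ ≠ 0 := by
  intro h0
  have := coeff_linXT c₀ c₁ c₂
  rw [h0, coeff_zero] at this
  exact h this.symm

theorem totalDegree_linXT {c₀ : ℂ} (h : c₀ ≠ 0) (c₁ c₂ : ℂ) :
    (linXT c₀ c₁ c₂).totalDegree = 1 := by
  apply le_antisymm
  · rw [totalDegree, Finset.sup_le_iff]
    intro m hm
    exact Nat.le_of_lt_succ (mem_degLT.1 (linXT_mem_degLT c₀ c₁ c₂) m hm)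
  · have := le_totalDegree (p := linXT c₀ c₁ c₂) (s := Finsupp.single 0 1) (by
      rw [mem_support_iff, coeff_linXT]
      exact h)
    simpa using this

theorem totalDegree_pow_of_ne_zero {σ : Type*} {p : MvPolynomial σ ℂ} (hp : p ≠ 0) (n : ℕ) :
    (p ^ n).totalDegree = n * p.totalDegree := by
  induction n with
  | zero => simp
  | succ n ih =>
    rw [pow_succ, totalDegree_mul_of_isDomain (pow_ne_zero n hp) hp, ih]
    ring

variable {σ : Type*}

/-- The coefficient of `ε ^ l` in `exp (ε v₀ + ε² v₁ + ε³ v₂)`. -/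
noncomputable def expCoeff (v₀ v₁ v₂ : MvPolynomial σ ℂ) (l : ℕ) : MvPolynomial σ ℂ :=
  ∑ m ∈ Finset.range (2 * l / 3 + 1), ∑ k ∈ Finset.Icc (l - 2 * m) ((2 * l - 3 * m) / 2),
    v₀ ^ k * C (1 / (k.factorial : ℂ))
      * (v₁ ^ (2 * l - 2 * k - 3 * m) * C (1 / ((2 * l - 2 * k - 3 * m).factorial : ℂ)))
      * (v₂ ^ (k + 2 * m - l) * C (1 / ((k + 2 * m - l).factorial : ℂ)))

theorem pow_mul_C_mem_degLT {v : MvPolynomial σ ℂ} (hv : v ∈ degLT σ 2) (n : ℕ) (c : ℂ) :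
    v ^ n * C c ∈ degLT σ (n + 1) := by
  have h : HasTop (∑ _i ∈ Finset.range n, 1) (∏ _i ∈ Finset.range n, v)
      (∏ _i ∈ Finset.range n, v) := HasTop.prod _ _ _ _ fun _ _ => HasTop.refl hv
  simp only [Finset.sum_const, Finset.prod_const, Finset.card_range, smul_eq_mul, mul_one] at h
  exact (h.mul (HasTop.C c)).1

theorem term_mem_degLT {v₀ v₁ v₂ : MvPolynomial σ ℂ} (h₀ : v₀ ∈ degLT σ 2)
    (h₁ : v₁ ∈ degLT σ 2) (h₂ : v₂ ∈ degLT σ 2) (k q r : ℕ) (c₀ c₁ c₂ : ℂ) :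
    v₀ ^ k * C c₀ * (v₁ ^ q * C c₁) * (v₂ ^ r * C c₂) ∈ degLT σ (k + q + r + 1) := by
  have h : v₀ ^ k * C c₀ * (v₁ ^ q * C c₁) ∈ degLT σ (k + q + 1) :=
    mul_mem_degLT (d := k) (e := q + 1) (pow_mul_C_mem_degLT h₀ k c₀)
      (pow_mul_C_mem_degLT h₁ q c₁)
  exact mul_mem_degLT (d := k + q) (e := r + 1) h (pow_mul_C_mem_degLT h₂ r c₂)

/-- The three exponents in a term add up to `l - m`, so only `m = 0` reaches degree `l`; there `k =
l` is forced. -/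
theorem hasTop_expCoeff {v₀ v₁ v₂ : MvPolynomial σ ℂ} (h₀ : v₀ ∈ degLT σ 2)
    (h₁ : v₁ ∈ degLT σ 2) (h₂ : v₂ ∈ degLT σ 2) (l : ℕ) :
    HasTop l (expCoeff v₀ v₁ v₂ l) (v₀ ^ l * C (1 / (l.factorial : ℂ))) := by
  have hsub : expCoeff v₀ v₁ v₂ l - v₀ ^ l * C (1 / (l.factorial : ℂ)) ∈ degLT σ l := by
    rw [expCoeff, Finset.sum_range_succ']
    have h0 : ∑ k ∈ Finset.Icc (l - 2 * 0) ((2 * l - 3 * 0) / 2),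
        v₀ ^ k * C (1 / (k.factorial : ℂ))
        * (v₁ ^ (2 * l - 2 * k - 3 * 0) * C (1 / ((2 * l - 2 * k - 3 * 0).factorial : ℂ)))
        * (v₂ ^ (k + 2 * 0 - l) * C (1 / ((k + 2 * 0 - l).factorial : ℂ))) =
        v₀ ^ l * C (1 / (l.factorial : ℂ)) := by
      rw [show (2 * l - 3 * 0) / 2 = l by omega, show l - 2 * 0 = l by omega, Finset.Icc_self,
        Finset.sum_singleton, show 2 * l - 2 * l - 3 * 0 = 0 by omega,
        show l + 2 * 0 - l = 0 by omega]
      simp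
    rw [h0, add_sub_cancel_right]
    refine Submodule.sum_mem _ fun m hm => Submodule.sum_mem _ fun k hk => ?_
    rw [Finset.mem_range] at hm
    rw [Finset.mem_Icc] at hk
    refine degLT_mono ?_ (term_mem_degLT h₀ h₁ h₂ k _ _ _ _ _)
    omega
  refine ⟨?_, hsub⟩
  have := Submodule.add_mem _ (degLT_mono (Nat.le_succ l) hsub)
    (pow_mul_C_mem_degLT h₀ l (1 / (l.factorial : ℂ)))
  simpa using this

/-- The upper triangular Toeplitz array with entries `expCoeff v₀ v₁ v₂ (i - a)`. -/
noncomputable def expToeplitz (v₀ v₁ v₂ : MvPolynomial σ ℂ) (a i : ℕ) : MvPolynomial σ ℂ :=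
  if a ≤ i then expCoeff v₀ v₁ v₂ (i - a) else 0

/-- The leading part of `expToeplitz`. -/
noncomputable def powToeplitz (v₀ : MvPolynomial σ ℂ) (a i : ℕ) : MvPolynomial σ ℂ :=
  if a ≤ i then v₀ ^ (i - a) * C (1 / ((i - a).factorial : ℂ)) else 0

theorem hasTop_expToeplitz {v₀ v₁ v₂ : MvPolynomial σ ℂ} (h₀ : v₀ ∈ degLT σ 2)
    (h₁ : v₁ ∈ degLT σ 2) (h₂ : v₂ ∈ degLT σ 2) (a i : ℕ) (hai : a ≤ i) :
    HasTop (i - a) (expToeplitz v₀ v₁ v₂ a i) (powToeplitz v₀ a i) := by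
  rw [expToeplitz, powToeplitz, if_pos hai, if_pos hai]
  exact hasTop_expCoeff h₀ h₁ h₂ _

theorem expToeplitz_of_lt (v₀ v₁ v₂ : MvPolynomial σ ℂ) (a i : ℕ) (hai : i < a) :
    expToeplitz v₀ v₁ v₂ a i = 0 ∧ powToeplitz v₀ a i = 0 := by
  rw [expToeplitz, powToeplitz, if_neg (not_le.2 hai), if_neg (not_le.2 hai)]
  exact ⟨rfl, rfl⟩

theorem Gam_eq_det {N j n : ℕ} (h : N - j = n) :
    Gam N j = (Matrix.of fun p q : Fin n =>
      if (p : ℕ) ≤ j + (q : ℕ) then (1 : ℂ) / ((j + (q : ℕ) - (p : ℕ)).factorial : ℂ)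
        else 0).det := by
  subst h
  rfl

theorem det_powToeplitz {v : MvPolynomial σ ℂ} (hv : v ≠ 0) {N j n : ℕ} (h : N - j = n) :
    (Matrix.of fun p q : Fin n => powToeplitz v p (j + q)).det =
      v ^ (j * n) * C (Gam N j) := by
  have := det_toeplitz_pow n j (fun m => (C (1 / (m.factorial : ℂ)) : MvPolynomial σ ℂ)) v hv
  simp only [powToeplitz]
  rw [this, Gam_eq_det h, RingHom.map_det]
  congr 2
  ext1 p q
  simp [apply_ite (C (σ := σ) (R := ℂ))]

/-- The odd numbers `2 i + 1` sum to `n²`. -/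
theorem prod_pow_mul_pow_succ {A : Type*} [CommRing A] (n : ℕ) (c s : A) :
    (∏ i : Fin n, c * s ^ (i : ℕ)) * ∏ i : Fin n, s ^ ((i : ℕ) + 1) = c ^ n * s ^ (n * n) := by
  rw [← Finset.prod_mul_distrib]
  induction n with
  | zero => simp
  | succ n ih =>
    rw [Fin.prod_univ_castSucc]
    simp only [Fin.val_castSucc, Fin.val_last, ih]
    ring

/-- Row and column scalings reduce this minor to the Pascal determinant `det_choose_succ`. -/
theorem det_entryB_succ_left (lam : ℂ) (n : ℕ) :
    (Matrix.of fun i l : Fin n => entryB lam (i + 1) l).det =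
      (1 / (lam - conj lam)) ^ n * (Complex.I / (conj lam - lam)) ^ (n * n) := by
  set c := 1 / (lam - conj lam) with hc
  set s := Complex.I / (conj lam - lam) with hs
  have h : (Matrix.of fun i l : Fin n => entryB lam (i + 1) l) =
      Matrix.diagonal (fun i : Fin n => s ^ ((i : ℕ) + 1)) *
      (Matrix.of fun a b : Fin n => ((((a : ℕ) + 1 + b).choose b : ℕ) : ℂ)) *
      Matrix.diagonal (fun i : Fin n => c * s ^ (i : ℕ)) := by
    ext i l
    rw [Matrix.mul_diagonal, Matrix.diagonal_mul]
    simp only [Matrix.of_apply, entryB, ← hc, ← hs]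
    rw [Nat.choose_symm_add]
    ring
  rw [h, Matrix.det_mul, Matrix.det_mul, det_choose_succ, Matrix.det_diagonal,
    Matrix.det_diagonal, ← prod_pow_mul_pow_succ]
  ring

theorem entryB_symm (lam : ℂ) (i l : ℕ) : entryB lam i l = entryB lam l i := by
  rw [entryB, entryB, Nat.choose_symm_add, add_comm i l]

theorem det_entryB_succ_right (lam : ℂ) (n : ℕ) :
    (Matrix.of fun i l : Fin n => entryB lam i (l + 1)).det =
      (1 / (lam - conj lam)) ^ n * (Complex.I / (conj lam - lam)) ^ (n * n) := by
  rw [← det_entryB_succ_left, ← Matrix.det_transpose]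
  congr 1
  ext i l
  exact entryB_symm _ _ _

theorem Gam_ne_zero (N j : ℕ) : Gam N j ≠ 0 := det_inv_factorial_ne_zero (N - j) j

end Polynomials

/-! ### Identification of the leading term and assembly -/

section Main

open MvPolynomial

variable (γ δ : ℝ) (lam : ℂ) (a : Fin 4 → ℂ)

/-- `vartheta0` as a polynomial in `x` and `t`. -/
noncomputable def poly0 : MvPolynomial (Fin 2) ℂ :=
  linXT (-2) (-8 * lam * (γ + 3 * δ * lam)) (2 * Complex.I * a 1)

/-- The complex conjugate of `vartheta0` as a polynomial in `x` and `t`. -/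
noncomputable def poly0c : MvPolynomial (Fin 2) ℂ :=
  linXT (-2) (conj (-8 * lam * (γ + 3 * δ * lam))) (conj (2 * Complex.I * a 1))

/-- `f γ δ lam a (i - l)` as a polynomial in `x` and `t`. -/
noncomputable def polyF : ℕ → ℕ → MvPolynomial (Fin 2) ℂ :=
  expToeplitz (poly0 γ δ lam a) (linXT 0 (-4 * Complex.I * (γ + 6 * δ * lam)) (-2 * a 2))
    (linXT 0 (8 * δ) (-2 * Complex.I * a 3))

/-- The complex conjugate of `f γ δ lam a (i - l)` as a polynomial in `x` and `t`. -/
noncomputable def polyFc : ℕ → ℕ → MvPolynomial (Fin 2) ℂ :=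
  expToeplitz (poly0c γ δ lam a)
    (linXT 0 (conj (-4 * Complex.I * (γ + 6 * δ * lam))) (conj (-2 * a 2)))
    (linXT 0 (conj (8 * δ : ℂ)) (conj (-2 * Complex.I * a 3)))

theorem eval_poly0 (x t : ℝ) :
    eval ![(x : ℂ), (t : ℂ)] (poly0 γ δ lam a) = vartheta0 γ δ lam a x t := by
  rw [poly0, eval_linXT, vartheta0]
  ring

/-- As `x` and `t` are real, conjugation acts on the coefficients alone. -/
theorem eval_poly0c (x t : ℝ) :
    eval ![(x : ℂ), (t : ℂ)] (poly0c γ δ lam a) = conj (vartheta0 γ δ lam a x t) := by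
  rw [poly0c, eval_linXT, ← eval_poly0, poly0, eval_linXT]
  simp only [map_add, map_mul, map_neg, map_ofNat, Complex.conj_ofReal]

theorem eval_polyF (x t : ℝ) (i j : ℕ) :
    eval ![(x : ℂ), (t : ℂ)] (polyF γ δ lam a i j) = toeplitzF γ δ lam a x t i j := by
  have h1 : (0 : ℂ) * x + -4 * Complex.I * (γ + 6 * δ * lam) * t + -2 * a 2 =
      vartheta1 γ δ lam a t := by
    rw [vartheta1]
    ring
  have h2 : (0 : ℂ) * x + 8 * δ * t + -2 * Complex.I * a 3 = vartheta2 δ a t := by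
    rw [vartheta2]
    ring
  rw [polyF, expToeplitz, toeplitzF]
  split_ifs
  · simp only [expCoeff, f, map_sum, map_mul, map_pow, eval_C, eval_linXT, eval_poly0, h1, h2,
      mul_one_div]
  · simp

theorem eval_polyFc (x t : ℝ) (i j : ℕ) :
    eval ![(x : ℂ), (t : ℂ)] (polyFc γ δ lam a i j) = conj (toeplitzF γ δ lam a x t i j) := by
  rw [← eval_polyF, polyFc, polyF, expToeplitz, expToeplitz]
  split_ifs
  · simp only [expCoeff, map_sum, map_mul, map_pow, eval_C, eval_linXT, eval_poly0, eval_poly0c,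
      map_add, map_div₀, map_one, map_zero, Complex.conj_ofReal, map_natCast]
  · simp

/-- The constant factor of `scrB`. -/
noncomputable def scrBCoeff (N j : ℕ) : ℂ :=
  (-1) ^ (N - j) * (-Complex.I) ^ (N - 1)
    * ((2 * lam.im : ℝ) : ℂ) ^ (-((N : ℤ) - j - 1) ^ 2 - (j : ℤ) ^ 2 - N + 1)
    * (Gam N j * Gam N (j + 1))

/-- `scrB` as a polynomial in `x` and `t`. -/
noncomputable def polyB (N j : ℕ) : MvPolynomial (Fin 2) ℂ :=
  C (scrBCoeff lam N j) * (poly0 γ δ lam a ^ ((N - j - 1) * (j + 1)) *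
    poly0c γ δ lam a ^ (j * (N - j)))

theorem evalXT_polyB (N j : ℕ) (x t : ℝ) :
    evalXT (polyB γ δ lam a N j) x t = scrB N γ δ lam a j x t := by
  rw [evalXT, polyB, scrB, scrBCoeff]
  simp only [map_mul, map_pow, eval_C, eval_poly0, eval_poly0c]
  ring

theorem totalDegree_polyB (hlam : lam.im ≠ 0) (N j : ℕ) :
    (polyB γ δ lam a N j).totalDegree = deg N j := by
  have hc : scrBCoeff lam N j ≠ 0 := by
    refine mul_ne_zero (mul_ne_zero (mul_ne_zero ?_ ?_) ?_)
      (mul_ne_zero (Gam_ne_zero _ _) (Gam_ne_zero _ _))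
    · exact pow_ne_zero _ (by simp)
    · exact pow_ne_zero _ (by simp)
    · exact zpow_ne_zero _ (by simpa using hlam)
  have h0 : poly0 γ δ lam a ≠ 0 := linXT_ne_zero (by simp) _ _
  have h0c : poly0c γ δ lam a ≠ 0 := linXT_ne_zero (by simp) _ _
  rw [polyB, totalDegree_mul_of_isDomain (by simpa using hc)
    (mul_ne_zero (pow_ne_zero _ h0) (pow_ne_zero _ h0c)), totalDegree_C,
    totalDegree_mul_of_isDomain (pow_ne_zero _ h0) (pow_ne_zero _ h0c),
    totalDegree_pow_of_ne_zero h0, totalDegree_pow_of_ne_zero h0c, poly0, poly0c,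
    totalDegree_linXT (by simp), totalDegree_linXT (by simp), deg]
  ring

/-- With `y = 2 Im λ₁` one has `1 / (λ₁ - λ₁*) = -i / y` and `i / (λ₁* - λ₁) = -1 / y`. The signs
agree because `n²` and `n` have the same parity. -/
theorem scrBCoeff_eq (hlam : lam.im ≠ 0) (j k : ℕ) :
    scrBCoeff lam (j + (k + 1)) j =
      -((-1) ^ j * ((1 / (lam - conj lam)) ^ j * (Complex.I / (conj lam - lam)) ^ (j * j)) *
        ((1 / (lam - conj lam)) ^ k * (Complex.I / (conj lam - lam)) ^ (k * k))) *
        (Gam (j + (k + 1)) j * Gam (j + (k + 1)) (j + 1)) := by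
  set y : ℂ := ((2 * lam.im : ℝ) : ℂ) with hy
  have hy0 : y ≠ 0 := by simpa [hy] using hlam
  have hsub : lam - conj lam = y * Complex.I := by rw [Complex.sub_conj]
  have hc : 1 / (lam - conj lam) = -Complex.I * y⁻¹ := by
    rw [hsub, one_div, mul_inv, Complex.inv_I]
    ring
  have hs : Complex.I / (conj lam - lam) = -1 * y⁻¹ := by
    rw [← neg_sub, hsub]
    field_simp
  have hexp : y ^ (-(((j + (k + 1) : ℕ) : ℤ) - j - 1) ^ 2 - (j : ℤ) ^ 2 - (j + (k + 1) : ℕ) + 1) =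
      y⁻¹ ^ (k * k + j * j + j + k) := by
    rw [show (-(((j + (k + 1) : ℕ) : ℤ) - j - 1) ^ 2 - (j : ℤ) ^ 2 - (j + (k + 1) : ℕ) + 1) =
      -((k * k + j * j + j + k : ℕ) : ℤ) by push_cast; ring, zpow_neg, zpow_natCast, inv_pow]
  have hsq : ∀ n : ℕ, (-1 : ℂ) ^ (n * n) = (-1) ^ n := by
    intro n
    rcases Nat.even_or_odd n with h | h
    · rw [h.neg_one_pow, (h.mul_left n).neg_one_pow]
    · rw [h.neg_one_pow, (h.mul h).neg_one_pow]
  have hjj : (-1 : ℂ) ^ j * (-1) ^ j = 1 := by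
    rw [← mul_pow]
    simp
  rw [scrBCoeff, ← hy, hexp, hc, hs, show j + (k + 1) - j = k + 1 by omega,
    show j + (k + 1) - 1 = j + k by omega]
  simp only [mul_pow, hsq, pow_add, pow_one]
  linear_combination ((-1) ^ k * (-Complex.I) ^ j * (-Complex.I) ^ k *
    (y⁻¹ ^ (k * k) * y⁻¹ ^ (j * j) * y⁻¹ ^ j * y⁻¹ ^ k) *
    (Gam (j + (k + 1)) j * Gam (j + (k + 1)) (j + 1))) * hjj

theorem neg_det_leading_eq_polyB (hlam : lam.im ≠ 0) (j k : ℕ) :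
    -(paddedTop (N := j + (k + 1)) (k + 1) (powToeplitz (poly0c γ δ lam a)) *
        middle (j + (k + 1)) (fun i l => (C (entryB lam i l) : MvPolynomial (Fin 2) ℂ)) *
        (paddedTop (N := j + (k + 1)) k
          (dropZero (powToeplitz (poly0 γ δ lam a))))ᵀ).det =
      polyB γ δ lam a (j + (k + 1)) j := by
  have h0 : poly0 γ δ lam a ≠ 0 := linXT_ne_zero (by simp) _ _
  have h0c : poly0c γ δ lam a ≠ 0 := linXT_ne_zero (by simp) _ _
  have hC : ∀ (n : ℕ) (e : Fin n → Fin n → ℂ),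
      (Matrix.of fun i l => (C (e i l) : MvPolynomial (Fin 2) ℂ)).det = C (Matrix.of e).det := by
    intro n e
    rw [RingHom.map_det]
    rfl
  rw [det_leading, det_powToeplitz h0c (N := j + (k + 1)) (by omega),
    det_powToeplitz h0 (N := j + (k + 1)) (by omega), hC, hC, det_entryB_succ_left,
    det_entryB_succ_right, polyB, scrBCoeff_eq lam hlam,
    show j + (k + 1) - j - 1 = k by omega, show j + (k + 1) - j = k + 1 by omega]
  simp only [map_mul, map_neg, map_pow, map_one]
  ring

theorem remainder_mem_degLT (hlam : lam.im ≠ 0) (N j : ℕ) (hj : j < N) :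
    -minorSum N (fun i l => C (entryB lam i l)) (polyFc γ δ lam a) (polyF γ δ lam a) (N - 1 - j)
      - polyB γ δ lam a N j ∈ degLT (Fin 2) (deg N j) := by
  obtain ⟨k, rfl⟩ : ∃ k, N = j + (k + 1) := ⟨N - j - 1, by omega⟩
  have h := minorSum_sub_det_leading_mem j k (entryB lam) (polyFc γ δ lam a)
    (powToeplitz (poly0c γ δ lam a)) (polyF γ δ lam a) (powToeplitz (poly0 γ δ lam a))
    (hasTop_expToeplitz (linXT_mem_degLT _ _ _) (linXT_mem_degLT _ _ _) (linXT_mem_degLT _ _ _))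
    (expToeplitz_of_lt _ _ _)
    (hasTop_expToeplitz (linXT_mem_degLT _ _ _) (linXT_mem_degLT _ _ _) (linXT_mem_degLT _ _ _))
    (expToeplitz_of_lt _ _ _)
  rw [← neg_det_leading_eq_polyB γ δ lam a hlam j k, show j + (k + 1) - 1 - j = k by omega, deg,
    show j + (k + 1) - j - 1 = k by omega, show j + (k + 1) - j = k + 1 by omega]
  have h' := Submodule.neg_mem _ h
  rw [neg_sub] at h'
  rw [sub_neg_eq_add, neg_add_eq_sub]
  exact h'

theorem det_G_eq_sum (N : ℕ) [NeZero N] (x t : ℝ) :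
    (G N γ δ lam a x t).det = ∑ j ∈ Finset.range N,
      Complex.exp (2 * conj (theta γ δ lam a x t)) *
        Complex.exp (2 * ((N : ℂ) - j - 1) * (theta γ δ lam a x t + conj (theta γ δ lam a x t))) *
        evalXT (-minorSum N (fun i l => C (entryB lam i l)) (polyFc γ δ lam a) (polyF γ δ lam a)
          (N - 1 - j)) x t := by
  -- Reflecting the range passes from the exponent `k` of `w` to `j = N - 1 - k`.
  rw [det_G_eq, det_padded_eq_sum, ← Finset.sum_range_reflect, Finset.mul_sum,
    ← Finset.sum_neg_distrib]
  refine Finset.sum_congr rfl fun j hj => ?_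
  rw [Finset.mem_range] at hj
  rw [← Complex.exp_nat_mul, evalXT, map_neg, map_minorSum]
  simp only [eval_C, eval_polyF, eval_polyFc]
  rw [show ((N - 1 - j : ℕ) : ℂ) = (N : ℂ) - j - 1 by
    rw [Nat.sub_sub, add_comm 1 j, Nat.cast_sub (by omega)]
    push_cast
    ring]
  rw [show ((N : ℂ) - j - 1) * (2 * (theta γ δ lam a x t + conj (theta γ δ lam a x t))) =
    2 * ((N : ℂ) - j - 1) * (theta γ δ lam a x t + conj (theta γ δ lam a x t)) by ring]
  ring

end Main

end HirotaSoliton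

theorem lemma4p4 (N : ℕ) [NeZero N] (γ δ : ℝ) (lam : ℂ) (hlam : lam.im ≠ 0) (a : Fin 4 → ℂ) :
    ∃ b r : ℕ → MvPolynomial (Fin 2) ℂ,
      (∀ j < N,
        (∀ x t : ℝ, HirotaSoliton.evalXT (b j) x t = HirotaSoliton.scrB N γ δ lam a j x t) ∧
        (b j).totalDegree = HirotaSoliton.deg N j ∧
        (∀ m ∈ (r j).support, m.degree < HirotaSoliton.deg N j)) ∧
      ∀ x t : ℝ,
        (HirotaSoliton.G N γ δ lam a x t).det =
          ∑ j ∈ Finset.range N,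
            Complex.exp (2 * (starRingEnd ℂ) (HirotaSoliton.theta γ δ lam a x t))
              * Complex.exp (2 * ((N : ℂ) - j - 1)
                  * (HirotaSoliton.theta γ δ lam a x t
                    + (starRingEnd ℂ) (HirotaSoliton.theta γ δ lam a x t)))
              * (HirotaSoliton.scrB N γ δ lam a j x t
                  + HirotaSoliton.evalXT (r j) x t) := by
  -- The remainder is the whole coefficient minus its leading part, so the expansion is immediate
  -- and the content lies in the degree bound.
  refine ⟨HirotaSoliton.polyB γ δ lam a N, fun j =>
    -HirotaSoliton.minorSum N (fun i l => MvPolynomial.C (HirotaSoliton.entryB lam i l))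
      (HirotaSoliton.polyFc γ δ lam a) (HirotaSoliton.polyF γ δ lam a) (N - 1 - j)
      - HirotaSoliton.polyB γ δ lam a N j, fun j hj => ⟨?_, ?_, ?_⟩, fun x t => ?_⟩
  · exact HirotaSoliton.evalXT_polyB γ δ lam a N j
  · exact HirotaSoliton.totalDegree_polyB γ δ lam a hlam N j
  · exact HirotaSoliton.mem_degLT.1 (HirotaSoliton.remainder_mem_degLT γ δ lam a hlam N j hj)
  · rw [HirotaSoliton.det_G_eq_sum]
    refine Finset.sum_congr rfl fun j _ => ?_
    rw [← HirotaSoliton.evalXT_polyB, HirotaSoliton.evalXT, HirotaSoliton.evalXT,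
      HirotaSoliton.evalXT, map_sub, add_sub_cancel]
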